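/- Let $\mathcal D$ be the family of dyadic intervals $I=[k2^n,(k+1)2^n)$, $k,n\in\mathbb Z$, with right and left halves $I_+,I_-$ and $L^2$-normalized Haar functions $h_I=|I|^{-1/2}(\mathbf 1_{I_+}-\mathbf 1_{I_-})$; $I$ is called even if $|I|=2^{-2k}$ for some $k\in\mathbb Z$. For a dyadic rectangle $R=I\times J$ put $h_R=h_I\otimes h_J$. Let $T_1$ be the bounded operator on real $L^2(\mathbb R^2)$ with $T_1(h_I\otimes h_J)=(h_{I_+}-h_{I_-})\otimes h_J$ if $I$ is even and $T_1(h_I\otimes h_J)=0$ otherwise, and let $T_2$ be its copy acting in the second variable. For a real function $b\in L^2_{loc}(\mathbb R^2)$ let $\mathcal T^b=[T_2,[T_1,b]]$, where $b$ stands for multiplication by $b$; this is defined on the dense subspace of $L^2(\mathbb R^2)$ of finite linear combinations of Haar functions $h_R$, and $\|\mathcal T^b\|\in[0,\infty]$ denotes its $L^2\to L^2$ operator norm. Put $$\|b\|_{BMO_r}^2=\sup_{R}\frac1{|R|}\sum_{R'\subset R}(b,h_{R'})^2\in[0,\infty],$$ where $R,R'$ run over dyadic rectangles. Theorem 9.1.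 There are absolute constants $C_1,C_2<\infty$ such that the following holds. Suppose that $b\in L^2_{loc}(\mathbb R^2)$ has Haar support only on (even, even) rectangles, that is, $(b,h_I\otimes h_J)\neq0$ implies that $I$ and $J$ are both even. Then for every dyadic open set $U_0$, i.e. every finite union of dyadic rectangles, $$\sum_{R\subset U_0}(b,h_R)^2\le C_1\|\mathcal T^b\|^2|U_0|+C_2\|b\|_{BMO_r}^2|U_0|,$$ where the sum is over all dyadic rectangles $R$ contained in $U_0$. -/

import Mathlib

open MeasureTheory Set
open scoped ENNReal NNReal

noncomputable section

namespace RepeatedCommutator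

/-- A dyadic interval `[k 2ⁿ, (k + 1) 2ⁿ)` of the usual dyadic lattice on the line
(`n = scale`, `k = index`, both arbitrary integers). -/
@[ext]
structure DyadicInterval where
  scale : ℤ
  index : ℤ

namespace DyadicInterval

/-- The underlying half-open interval. -/
def toSet (I : DyadicInterval) : Set ℝ :=
  Ico ((I.index : ℝ) * (2 : ℝ) ^ I.scale) (((I.index : ℝ) + 1) * (2 : ℝ) ^ I.scale)

/-- The length `|I| = 2ⁿ`. -/
def length (I : DyadicInterval) : ℝ := (2 : ℝ) ^ I.scale

/-- `I` is even if `|I| = 2^(-2k)` for some integer `k`. -/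
def IsEven (I : DyadicInterval) : Prop := Even I.scale

/-- The right half `I₊`. -/
def right (I : DyadicInterval) : DyadicInterval := ⟨I.scale - 1, 2 * I.index + 1⟩

/-- The left half `I₋`. -/
def left (I : DyadicInterval) : DyadicInterval := ⟨I.scale - 1, 2 * I.index⟩

/-- The `L²`-normalized Haar function `h_I = |I|^(-1/2) (1_{I₊} - 1_{I₋})`. -/
def haar (I : DyadicInterval) (x : ℝ) : ℝ :=
  (√I.length)⁻¹ * (I.right.toSet.indicator 1 x - I.left.toSet.indicator 1 x)

end DyadicInterval

/-- A dyadic rectangle `R = I × J`. -/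
abbrev DyadicRectangle := DyadicInterval × DyadicInterval

namespace DyadicRectangle

/-- The underlying subset of the plane. -/
def toSet (R : DyadicRectangle) : Set (ℝ × ℝ) := R.1.toSet ×ˢ R.2.toSet

/-- The Haar function `h_R = h_I ⊗ h_J`. -/
def haar (R : DyadicRectangle) (p : ℝ × ℝ) : ℝ := R.1.haar p.1 * R.2.haar p.2

end DyadicRectangle

theorem DyadicInterval.memLp_haar (I : DyadicInterval) : MemLp I.haar 2 volume := by
  have h : ∀ K : DyadicInterval, MemLp (K.toSet.indicator (1 : ℝ → ℝ)) 2 volume := fun K =>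
    memLp_indicator_const 2 measurableSet_Ico (1 : ℝ) (Or.inr (by simp))
  exact ((h I.right).sub (h I.left)).const_mul _

theorem DyadicRectangle.memLp_haar (R : DyadicRectangle) :
    MemLp (DyadicRectangle.haar R) 2 (volume : Measure (ℝ × ℝ)) := by
  have h1 := R.1.memLp_haar
  have h2 := R.2.memLp_haar
  rw [Measure.volume_eq_prod]
  refine (memLp_two_iff_integrable_sq
    (h1.aestronglyMeasurable.comp_fst.mul h2.aestronglyMeasurable.comp_snd)).2 ?_
  have := h1.integrable_sq.mul_prod h2.integrable_sq
  exact this.congr (Filter.Eventually.of_forall fun p => by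
    simp only [Pi.mul_apply, mul_pow])

/-- The Hilbert space `L²(ℝ²)` of real functions of `(x, y)`. -/
abbrev L2Plane := Lp ℝ 2 (volume : Measure (ℝ × ℝ))

/-- `h_R` as an element of `L²(ℝ²)`. -/
def haarL2 (R : DyadicRectangle) : L2Plane := (DyadicRectangle.memLp_haar R).toLp

/-- The Haar coefficient `(b, h_R)`. -/
def haarCoeff (b : ℝ × ℝ → ℝ) (R : DyadicRectangle) : ℝ :=
  ∫ p, b p * DyadicRectangle.haar R p

open Classical in
/-- The value of `T₁ ⊗ id` on `h_I ⊗ h_J`: `(h_{I₊} - h_{I₋}) ⊗ h_J` if `I` is even, else `0`. -/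
def shiftHaar₁ (R : DyadicRectangle) : L2Plane :=
  if R.1.IsEven then haarL2 (R.1.right, R.2) - haarL2 (R.1.left, R.2) else 0

open Classical in
/-- The value of `id ⊗ T₂` on `h_I ⊗ h_J`: `h_I ⊗ (h_{J₊} - h_{J₋})` if `J` is even, else `0`. -/
def shiftHaar₂ (R : DyadicRectangle) : L2Plane :=
  if R.2.IsEven then haarL2 (R.1, R.2.right) - haarL2 (R.1, R.2.left) else 0

/-- The dyadic shift `T₁`, acting on `L²(ℝ²)` in the variable `x`. As the `h_R` form an orthonormal
basis of `L²(ℝ²)` and `T₁` is bounded, it is given by this series, which always converges. -/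
def shift₁ (f : L2Plane) : L2Plane := ∑' R, inner ℝ (haarL2 R) f • shiftHaar₁ R

/-- The dyadic shift `T₂`, acting on `L²(ℝ²)` in the variable `y`. -/
def shift₂ (f : L2Plane) : L2Plane := ∑' R, inner ℝ (haarL2 R) f • shiftHaar₂ R

open Classical in
/-- Multiplication by `b`. It is unbounded in general: the value is the product `b f` when this is
square integrable (in particular for locally square integrable `b` and `f` a finite linear
combination of Haar functions), and the default `0` otherwise. -/
def mulBy (b : ℝ × ℝ → ℝ) (f : L2Plane) : L2Plane :=
  if h : MemLp (fun p => b p * f p) 2 volume then h.toLp else 0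

/-- The commutator `[A, B] = AB - BA`. -/
def comm (A B : L2Plane → L2Plane) (f : L2Plane) : L2Plane := A (B f) - B (A f)

/-- The repeated commutator `𝒯ᵇ = [T₂, [T₁, b]]`. -/
def repeatedComm (b : ℝ × ℝ → ℝ) : L2Plane → L2Plane := comm shift₂ (comm shift₁ (mulBy b))

/-- The finite linear combinations of Haar functions, a dense subspace of `L²(ℝ²)`. -/
def haarSpan : Submodule ℝ L2Plane := Submodule.span ℝ (range haarL2)

/-- The operator norm `‖𝒯ᵇ‖ ∈ [0, ∞]` on `L²(ℝ²)` of the densely defined operator `𝒯ᵇ`; it is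
finite exactly if `𝒯ᵇ` extends to a bounded operator on `L²(ℝ²)`. -/
def repeatedCommNorm (b : ℝ × ℝ → ℝ) : ℝ≥0∞ :=
  ⨆ f ∈ haarSpan, ⨆ _ : ‖f‖ ≤ 1, ‖repeatedComm b f‖ₑ

/-- `∑_{R ⊂ U} (b, h_R)²`, the sum over all dyadic rectangles contained in `U`. -/
def haarEnergy (b : ℝ × ℝ → ℝ) (U : Set (ℝ × ℝ)) : ℝ≥0∞ :=
  ∑' R : {R : DyadicRectangle // DyadicRectangle.toSet R ⊆ U}, ENNReal.ofReal (haarCoeff b R ^ 2)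

/-- The rectangular `BMO` norm, `‖b‖²_{BMO_r} = sup_R |R|⁻¹ ∑_{R' ⊂ R} (b, h_{R'})²`. -/
def rectBMONorm (b : ℝ × ℝ → ℝ) : ℝ≥0∞ :=
  (⨆ R : DyadicRectangle,
    haarEnergy b (DyadicRectangle.toSet R) / volume (DyadicRectangle.toSet R)) ^ (1 / 2 : ℝ)

/-- A dyadic open set: a finite union of dyadic rectangles. -/
def IsDyadicOpen (U : Set (ℝ × ℝ)) : Prop :=
  ∃ F : Finset DyadicRectangle, U = ⋃ R ∈ F, DyadicRectangle.toSet R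

/-- `b` belongs to `L²_loc(ℝ²)`. -/
def LocallySquareIntegrable (b : ℝ × ℝ → ℝ) : Prop :=
  ∀ K : Set (ℝ × ℝ), IsCompact K → MemLp b 2 (volume.restrict K)

/-- `b` skips scales: its Haar support consists of (even, even) rectangles. -/
def SkipsScales (b : ℝ × ℝ → ℝ) : Prop :=
  ∀ R : DyadicRectangle, haarCoeff b R ≠ 0 → R.1.IsEven ∧ R.2.IsEven

end RepeatedCommutator

end

/-! The operators satisfy `T₁* T₁ = 2` and `T₂* T₂ = 2` on even intervals. Hence pairing `[T₂, [T₁,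
b]] h_S` with `T₁T₂ h_R`, for `R` (even, even), amounts to integrating `b` against a tensor product
of one-variable symbols `2 h_K h_I - (T h_K)(T h_I)`, where `I` is a side of `R` and `K` the
corresponding side of `S` (`inner_shiftHaar₁₂_repeatedComm_haarL2`).

The symbol vanishes for `K = I`, because both products equal `2|I|⁻¹ 1_I`. For `K ≠ I` the product
`(T h_K)(T h_I)` is a combination of Haar functions of odd intervals, to which `b` is blind, while
`h_K h_I` is zero or a multiple of the Haar function of the smaller interval. So only Haar functions
`h_M` with `M ⊆ I` remain, and their coefficients are integrals of `h_K` over `I` against `2 h_I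
h_M` (`commutator_symbol_mem_oddSpan`). The pairing of `𝒯ᵇ f` with `T₁T₂ h_R` therefore depends only
on `f` restricted to `R`. If `f = c` there, orthogonality leaves just `4c (b, h_R)`
(`inner_shiftHaar₁₂_repeatedComm_of_const`).

The vectors `½ T₁T₂ h_R` are orthonormal, so Bessel's inequality bounds the sum of `4c² (b, h_R)²`
over `R ⊆ U` by `‖𝒯ᵇ f‖²` as soon as `f = c` on all of `U`. The indicator of `U` need not be a
finite Haar combination. It is corrected outside `U` to one with squared norm `4|U|`
(`exists_haarSpan_eq_one`), and normalizing gives the bound with constant 1. -/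

noncomputable section

namespace RepeatedCommutator

/-! ### Dyadic intervals and the orthonormality of Haar functions on the line. -/

namespace DyadicInterval

theorem length_pos (I : DyadicInterval) : 0 < I.length := zpow_pos two_pos _

theorem measurableSet_toSet (I : DyadicInterval) : MeasurableSet I.toSet := measurableSet_Ico

theorem volume_toSet (I : DyadicInterval) : volume I.toSet = ENNReal.ofReal I.length := by
  rw [toSet, Real.volume_Ico, length]; ring_nf

theorem volume_real_toSet (I : DyadicInterval) : volume.real I.toSet = I.length := by
  rw [measureReal_def, volume_toSet, ENNReal.toReal_ofReal I.length_pos.le]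

theorem toSet_nonempty (I : DyadicInterval) : I.toSet.Nonempty :=
  nonempty_Ico.2 (by have := I.length_pos; rw [length] at this; nlinarith)

theorem mem_toSet_iff (I : DyadicInterval) (x : ℝ) :
    x ∈ I.toSet ↔ ⌊x / (2 : ℝ) ^ I.scale⌋ = I.index := by
  have h : (0 : ℝ) < 2 ^ I.scale := zpow_pos two_pos _
  rw [Int.floor_eq_iff, toSet, mem_Ico, le_div_iff₀ h, div_lt_iff₀ h]

theorem length_left (I : DyadicInterval) : I.left.length = I.length / 2 := by
  simp [length, left, zpow_sub_one₀, div_eq_mul_inv]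

theorem length_right (I : DyadicInterval) : I.right.length = I.length / 2 := by
  simp [length, right, zpow_sub_one₀, div_eq_mul_inv]

theorem left_union_right (I : DyadicInterval) : I.left.toSet ∪ I.right.toSet = I.toSet := by
  have h : (0 : ℝ) < 2 ^ I.scale := zpow_pos two_pos _
  have e : (2 : ℝ) ^ (I.scale - 1) = 2 ^ I.scale / 2 := by simp [zpow_sub_one₀, div_eq_mul_inv]
  simp only [toSet, left, right, e]
  push_cast
  rw [show (2 * (I.index : ℝ) + 1) * (2 ^ I.scale / 2) = (I.index : ℝ) * 2 ^ I.scale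
    + 2 ^ I.scale / 2 by ring, show 2 * (I.index : ℝ) * (2 ^ I.scale / 2)
    = (I.index : ℝ) * 2 ^ I.scale by ring, show (2 * (I.index : ℝ) + 1 + 1) * (2 ^ I.scale / 2)
    = ((I.index : ℝ) + 1) * 2 ^ I.scale by ring]
  exact Ico_union_Ico_eq_Ico (by linarith) (by linarith)

theorem left_subset (I : DyadicInterval) : I.left.toSet ⊆ I.toSet :=
  I.left_union_right ▸ subset_union_left

theorem right_subset (I : DyadicInterval) : I.right.toSet ⊆ I.toSet :=
  I.left_union_right ▸ subset_union_right

theorem disjoint_of_scale_eq {I K : DyadicInterval} (h : I.scale = K.scale) (hne : I ≠ K) :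
    Disjoint I.toSet K.toSet := by
  rw [Set.disjoint_left]
  intro x hI hK
  rw [mem_toSet_iff] at hI hK
  exact hne (DyadicInterval.ext h (by rw [← hI, ← hK, h]))

theorem disjoint_left_right (I : DyadicInterval) : Disjoint I.left.toSet I.right.toSet :=
  disjoint_of_scale_eq rfl fun h => by
    have := congrArg index h
    simp only [left, right] at this
    omega

/-- The index of the coarse interval containing `x` is the integer quotient by `2 ^ d` of the fine
index, so it is constant on each fine interval. -/
theorem subset_or_disjoint {I K : DyadicInterval} (h : I.scale ≤ K.scale) :
    I.toSet ⊆ K.toSet ∨ Disjoint I.toSet K.toSet := by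
  obtain ⟨d, hd⟩ := Int.le.dest h
  have key (x : ℝ) : ⌊x / (2 : ℝ) ^ K.scale⌋ = ⌊x / (2 : ℝ) ^ I.scale⌋ / (2 ^ d : ℕ) := by
    rw [← Int.floor_div_natCast, ← hd, zpow_add₀ two_ne_zero, div_div]
    simp
  by_cases hx : ∃ x, x ∈ I.toSet ∧ x ∈ K.toSet
  · obtain ⟨x, hI, hK⟩ := hx
    left
    intro y hy
    rw [mem_toSet_iff] at *
    rw [key] at *
    rw [hy, ← hK, hI]
  · right
    rw [Set.disjoint_left]
    exact fun x hI hK => hx ⟨x, hI, hK⟩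

/-- The trichotomy for two dyadic intervals: one is contained in a half of the other, they are
disjoint, or they coincide. -/
theorem nested_or_disjoint (I K : DyadicInterval) :
    I = K ∨ Disjoint I.toSet K.toSet ∨ (I.toSet ⊆ K.left.toSet ∨ I.toSet ⊆ K.right.toSet) ∨
      (K.toSet ⊆ I.left.toSet ∨ K.toSet ⊆ I.right.toSet) := by
  have main (I K : DyadicInterval) (h : I.scale < K.scale) : Disjoint I.toSet K.toSet ∨
      (I.toSet ⊆ K.left.toSet ∨ I.toSet ⊆ K.right.toSet) := by
    have hl := subset_or_disjoint (I := I) (K := K.left) (by simp only [left]; omega)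
    have hr := subset_or_disjoint (I := I) (K := K.right) (by simp only [right]; omega)
    rcases hl with hl | hl
    · exact Or.inr (Or.inl hl)
    rcases hr with hr | hr
    · exact Or.inr (Or.inr hr)
    · exact Or.inl (K.left_union_right ▸ Set.disjoint_union_right.2 ⟨hl, hr⟩)
  rcases lt_trichotomy I.scale K.scale with h | h | h
  · have := main I K h; tauto
  · by_cases e : I = K
    · exact Or.inl e
    · exact Or.inr (Or.inl (disjoint_of_scale_eq h e))
  · have := main K I h
    rw [disjoint_comm] at this
    tauto

theorem haar_eq_zero {I : DyadicInterval} {x : ℝ} (h : x ∉ I.toSet) : I.haar x = 0 := by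
  rw [haar, indicator_of_notMem fun h' => h (I.right_subset h'),
    indicator_of_notMem fun h' => h (I.left_subset h')]
  simp

theorem haar_of_mem_right {I : DyadicInterval} {x : ℝ} (h : x ∈ I.right.toSet) :
    I.haar x = (√I.length)⁻¹ := by
  rw [haar, indicator_of_mem h, indicator_of_notMem (Set.disjoint_right.1 I.disjoint_left_right h)]
  simp

theorem haar_of_mem_left {I : DyadicInterval} {x : ℝ} (h : x ∈ I.left.toSet) :
    I.haar x = -(√I.length)⁻¹ := by
  rw [haar, indicator_of_mem h, indicator_of_notMem (Set.disjoint_left.1 I.disjoint_left_right h)]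
  simp

theorem haar_mul_self (I : DyadicInterval) (x : ℝ) :
    I.haar x * I.haar x = I.length⁻¹ * I.toSet.indicator 1 x := by
  have hs : (√I.length)⁻¹ * (√I.length)⁻¹ = I.length⁻¹ := by
    rw [← mul_inv, Real.mul_self_sqrt I.length_pos.le]
  by_cases hx : x ∈ I.toSet
  · rw [indicator_of_mem hx, Pi.one_apply, mul_one, ← hs]
    rw [← left_union_right] at hx
    rcases hx with hx | hx
    · rw [haar_of_mem_left hx, neg_mul_neg]
    · rw [haar_of_mem_right hx]
  · rw [haar_eq_zero hx, indicator_of_notMem hx]; simp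

/-- A Haar function is constant on the dyadic intervals inside either half of its support. -/
theorem exists_haar_eq_const {I K : DyadicInterval}
    (h : I.toSet ⊆ K.left.toSet ∨ I.toSet ⊆ K.right.toSet) : ∃ c, ∀ x ∈ I.toSet, K.haar x = c := by
  rcases h with h | h
  · exact ⟨_, fun x hx => haar_of_mem_left (h hx)⟩
  · exact ⟨_, fun x hx => haar_of_mem_right (h hx)⟩

theorem integral_haar (I : DyadicInterval) : ∫ x, I.haar x = 0 := by
  have hi (K : DyadicInterval) : Integrable (K.toSet.indicator (1 : ℝ → ℝ)) :=
    (integrable_indicator_iff K.measurableSet_toSet).2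
      (integrableOn_const (by rw [volume_toSet]; exact ENNReal.ofReal_ne_top))
  have hv (K : DyadicInterval) : ∫ x, K.toSet.indicator (1 : ℝ → ℝ) x = K.length := by
    rw [integral_indicator_one K.measurableSet_toSet, volume_real_toSet]
  simp only [haar]
  rw [integral_const_mul, integral_sub (hi _) (hi _), hv, hv, length_left, length_right]
  simp

theorem integral_haar_mul_self (I : DyadicInterval) : ∫ x, I.haar x * I.haar x = 1 := by
  simp only [haar_mul_self]
  rw [integral_const_mul, integral_indicator_one I.measurableSet_toSet, volume_real_toSet,
    inv_mul_cancel₀ I.length_pos.ne']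

theorem haar_mul_haar_of_disjoint {I K : DyadicInterval} (h : Disjoint I.toSet K.toSet) (x : ℝ) :
    I.haar x * K.haar x = 0 := by
  by_cases hx : x ∈ I.toSet
  · rw [haar_eq_zero (Set.disjoint_left.1 h hx), mul_zero]
  · rw [haar_eq_zero hx, zero_mul]

/-- When the intervals are nested, the larger Haar function is constant on the support of the
smaller one, which has mean zero. -/
theorem integral_haar_mul_haar_of_ne {I K : DyadicInterval} (hne : I ≠ K) :
    ∫ x, I.haar x * K.haar x = 0 := by
  have nested (I K : DyadicInterval) (h : I.toSet ⊆ K.left.toSet ∨ I.toSet ⊆ K.right.toSet) :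
      ∫ x, I.haar x * K.haar x = 0 := by
    obtain ⟨c, hc⟩ := exists_haar_eq_const h
    have (x : ℝ) : I.haar x * K.haar x = I.haar x * c := by
      by_cases hx : x ∈ I.toSet
      · rw [hc x hx]
      · rw [haar_eq_zero hx, zero_mul, zero_mul]
    simp only [this]
    rw [integral_mul_const, integral_haar, zero_mul]
  rcases nested_or_disjoint I K with h | h | h | h
  · exact absurd h hne
  · simp only [haar_mul_haar_of_disjoint h, integral_zero]
  · exact nested I K h
  · rw [← nested K I h]; simp only [mul_comm]

theorem integral_haar_mul_haar [DecidableEq DyadicInterval] (I K : DyadicInterval) :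
    ∫ x, I.haar x * K.haar x = if I = K then 1 else 0 := by
  split_ifs with h
  · rw [h, integral_haar_mul_self]
  · exact integral_haar_mul_haar_of_ne h

end DyadicInterval

/-! ### Test functions, their tensor products, and integration against `b`. -/

/-- The bounded Borel functions on the line with bounded support. -/
def testFunctions : Submodule ℝ (ℝ → ℝ) where
  carrier := {φ | Measurable φ ∧ (∃ C, ∀ x, |φ x| ≤ C) ∧ ∃ r, ∀ x, r < |x| → φ x = 0}
  add_mem' := by
    rintro φ ψ ⟨hφ, ⟨C, hC⟩, r, hr⟩ ⟨hψ, ⟨C', hC'⟩, r', hr'⟩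
    refine ⟨hφ.add hψ, ⟨C + C', fun x => (abs_add_le _ _).trans (add_le_add (hC x) (hC' x))⟩,
      max r r', fun x hx => ?_⟩
    rw [max_lt_iff] at hx
    simp [hr x hx.1, hr' x hx.2]
  zero_mem' := ⟨measurable_zero, ⟨0, by simp⟩, 0, by simp⟩
  smul_mem' := by
    rintro c φ ⟨hφ, ⟨C, hC⟩, r, hr⟩
    refine ⟨hφ.const_smul c, ⟨|c| * C, fun x => ?_⟩, r, fun x hx => by simp [hr x hx]⟩
    rw [Pi.smul_apply, smul_eq_mul, abs_mul]
    exact mul_le_mul_of_nonneg_left (hC x) (abs_nonneg c)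

theorem testFunctions.mul_mem {φ ψ : ℝ → ℝ} (hφ : φ ∈ testFunctions) (hψ : ψ ∈ testFunctions) :
    φ * ψ ∈ testFunctions := by
  obtain ⟨hφ, ⟨C, hC⟩, r, hr⟩ := hφ
  obtain ⟨hψ, ⟨C', hC'⟩, -⟩ := hψ
  refine ⟨hφ.mul hψ, ⟨C * C', fun x => ?_⟩, r, fun x hx => by simp [hr x hx]⟩
  rw [Pi.mul_apply, abs_mul]
  exact mul_le_mul (hC x) (hC' x) (abs_nonneg _) ((abs_nonneg _).trans (hC x))

/-- Closure under products lets `h_K h_I` and `(T h_K)(T h_I)` be arguments of the bilinear form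
`pairing`. -/
instance : Mul testFunctions := ⟨fun φ ψ => ⟨φ.1 * ψ.1, testFunctions.mul_mem φ.2 ψ.2⟩⟩

@[simp] theorem testFunctions.coe_mul (φ ψ : testFunctions) (x : ℝ) :
    (φ * ψ).1 x = φ.1 x * ψ.1 x := rfl

@[simp] theorem testFunctions.coe_add (φ ψ : testFunctions) (x : ℝ) :
    (φ + ψ).1 x = φ.1 x + ψ.1 x := rfl

@[simp] theorem testFunctions.coe_sub (φ ψ : testFunctions) (x : ℝ) :
    (φ - ψ).1 x = φ.1 x - ψ.1 x := rfl

@[simp] theorem testFunctions.coe_smul (c : ℝ) (φ : testFunctions) (x : ℝ) :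
    (c • φ).1 x = c * φ.1 x := rfl

@[simp] theorem testFunctions.coe_zero (x : ℝ) : (0 : testFunctions).1 x = 0 := rfl

namespace DyadicInterval

theorem indicator_mem_testFunctions (I : DyadicInterval) :
    I.toSet.indicator 1 ∈ testFunctions := by
  refine ⟨measurable_one.indicator I.measurableSet_toSet, ⟨1, fun x => ?_⟩, ?_⟩
  · by_cases hx : x ∈ I.toSet <;> simp [hx]
  · have hb : Bornology.IsBounded I.toSet := Metric.isBounded_Ico _ _
    obtain ⟨r, hr⟩ := hb.exists_norm_le
    exact ⟨r, fun x hx => indicator_of_notMem (fun h => absurd (hr x h) (not_le.2 hx)) _⟩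

/-- The indicator of a dyadic interval as a test function. -/
def ind (I : DyadicInterval) : testFunctions := ⟨I.toSet.indicator 1, I.indicator_mem_testFunctions⟩

/-- The Haar function of a dyadic interval as a test function. -/
def haarT (I : DyadicInterval) : testFunctions := (√I.length)⁻¹ • (I.right.ind - I.left.ind)

theorem coe_haarT (I : DyadicInterval) (x : ℝ) : I.haarT.1 x = I.haar x := rfl

theorem coe_ind (I : DyadicInterval) (x : ℝ) : I.ind.1 x = I.toSet.indicator 1 x := rfl

open Classical in
/-- The image of `h_I` under the dyadic shift, as a test function. -/
def shiftT (I : DyadicInterval) : testFunctions := if I.IsEven then I.right.haarT - I.left.haarT else 0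

end DyadicInterval

/-- The tensor product of two functions on the line. -/
def tensor (φ ψ : ℝ → ℝ) (p : ℝ × ℝ) : ℝ := φ p.1 * ψ p.2

theorem LocallySquareIntegrable.memLp_mul {b : ℝ × ℝ → ℝ} (hb : LocallySquareIntegrable b)
    {φ ψ : ℝ → ℝ} (hφ : φ ∈ testFunctions) (hψ : ψ ∈ testFunctions) :
    MemLp (fun p => b p * tensor φ ψ p) 2 volume := by
  obtain ⟨hφ, ⟨C, hC⟩, r, hr⟩ := hφ
  obtain ⟨hψ, ⟨C', hC'⟩, r', hr'⟩ := hψ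
  set K : Set (ℝ × ℝ) := Metric.closedBall 0 r ×ˢ Metric.closedBall 0 r' with hK
  have hKc : IsCompact K := (isCompact_closedBall _ _).prod (isCompact_closedBall _ _)
  have h1 : MemLp (K.indicator b) 2 volume :=
    (memLp_indicator_iff_restrict hKc.measurableSet).2 (hb K hKc)
  have hm : Measurable (tensor φ ψ) := (hφ.comp measurable_fst).mul (hψ.comp measurable_snd)
  have e : (fun p => b p * tensor φ ψ p) = fun p => K.indicator b p * tensor φ ψ p := by
    funext p
    by_cases hp : p ∈ K
    · rw [indicator_of_mem hp]
    · have : tensor φ ψ p = 0 := by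
        rw [hK, mem_prod, not_and_or] at hp
        simp only [Metric.mem_closedBall, dist_zero_right, not_le, Real.norm_eq_abs] at hp
        rcases hp with hp | hp
        · simp [tensor, hr _ hp]
        · simp [tensor, hr' _ hp]
      rw [this, mul_zero, mul_zero]
  rw [e]
  refine h1.of_le_mul (c := C * C') (h1.aestronglyMeasurable.mul hm.aestronglyMeasurable)
    (Filter.Eventually.of_forall fun p => ?_)
  rw [norm_mul, mul_comm]
  refine mul_le_mul_of_nonneg_right ?_ (norm_nonneg _)
  rw [Real.norm_eq_abs, tensor, abs_mul]
  exact mul_le_mul (hC _) (hC' _) (abs_nonneg _) ((abs_nonneg _).trans (hC p.1))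

theorem locallySquareIntegrable_one : LocallySquareIntegrable 1 := fun K hK =>
  have : IsFiniteMeasure (volume.restrict K) :=
    ⟨by rw [Measure.restrict_apply_univ]; exact hK.measure_lt_top⟩
  memLp_const (1 : ℝ)

theorem memLp_tensor (φ ψ : testFunctions) : MemLp (tensor φ.1 ψ.1) 2 volume := by
  simpa using locallySquareIntegrable_one.memLp_mul φ.2 ψ.2

/-- The tensor product of test functions as a bilinear map into `L²(ℝ²)`. -/
def tens : testFunctions →ₗ[ℝ] testFunctions →ₗ[ℝ] L2Plane :=
  LinearMap.mk₂ ℝ (fun φ ψ => (memLp_tensor φ ψ).toLp)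
    (fun φ φ' ψ => by
      rw [← MemLp.toLp_add]; congr 1; funext p; simp [tensor, add_mul])
    (fun c φ ψ => by
      rw [← MemLp.toLp_const_smul]; congr 1; funext p; simp [tensor, mul_assoc])
    (fun φ ψ ψ' => by
      rw [← MemLp.toLp_add]; congr 1; funext p; simp [tensor, mul_add])
    (fun c φ ψ => by
      rw [← MemLp.toLp_const_smul]; congr 1; funext p; simp [tensor, mul_left_comm])

theorem coeFn_tens (φ ψ : testFunctions) : tens φ ψ =ᵐ[volume] tensor φ.1 ψ.1 :=
  (memLp_tensor φ ψ).coeFn_toLp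

theorem haarL2_eq_tens (R : DyadicRectangle) : haarL2 R = tens R.1.haarT R.2.haarT := rfl

theorem shiftHaar₁_eq_tens (R : DyadicRectangle) : shiftHaar₁ R = tens R.1.shiftT R.2.haarT := by
  rw [shiftHaar₁, DyadicInterval.shiftT]
  split_ifs <;> simp [haarL2_eq_tens]

theorem shiftHaar₂_eq_tens (R : DyadicRectangle) : shiftHaar₂ R = tens R.1.haarT R.2.shiftT := by
  rw [shiftHaar₂, DyadicInterval.shiftT]
  split_ifs <;> simp [haarL2_eq_tens]

theorem inner_tens_eq_integral (φ ψ : testFunctions) (f : L2Plane) :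
    inner ℝ (tens φ ψ) f = ∫ p, f p * tensor φ.1 ψ.1 p := by
  rw [L2.inner_def]
  refine integral_congr_ae ?_
  filter_upwards [coeFn_tens φ ψ] with p hp
  rw [hp]; simp

theorem inner_tens_tens (φ ψ φ' ψ' : testFunctions) :
    inner ℝ (tens φ ψ) (tens φ' ψ') = (∫ x, φ.1 x * φ'.1 x) * ∫ y, ψ.1 y * ψ'.1 y := by
  rw [inner_tens_eq_integral, ← integral_prod_mul]
  refine integral_congr_ae ?_
  filter_upwards [coeFn_tens φ' ψ'] with p hp
  rw [hp]; simp only [tensor]; ring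

theorem LocallySquareIntegrable.integrable_mul {b : ℝ × ℝ → ℝ} (hb : LocallySquareIntegrable b)
    (φ ψ : testFunctions) : Integrable (fun p => b p * tensor φ.1 ψ.1 p) := by
  obtain ⟨-, -, r, hr⟩ := φ.2
  obtain ⟨-, -, r', hr'⟩ := ψ.2
  set K : Set (ℝ × ℝ) := Metric.closedBall 0 r ×ˢ Metric.closedBall 0 r'
  have hK : IsCompact K := (isCompact_closedBall _ _).prod (isCompact_closedBall _ _)
  have : IsFiniteMeasure (volume.restrict K) :=
    ⟨by rw [Measure.restrict_apply_univ]; exact hK.measure_lt_top⟩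
  have h : IntegrableOn (fun p => b p * tensor φ.1 ψ.1 p) K :=
    ((hb.memLp_mul φ.2 ψ.2).restrict _).integrable one_le_two
  refine (integrableOn_iff_integrable_of_support_subset fun p hp => ?_).1 h
  rw [Function.mem_support, tensor, mul_ne_zero_iff, mul_ne_zero_iff] at hp
  simp only [K, mem_prod, Metric.mem_closedBall, dist_zero_right, Real.norm_eq_abs]
  exact ⟨not_lt.1 fun h => hp.2.1 (hr _ h), not_lt.1 fun h => hp.2.2 (hr' _ h)⟩

/-- The integral of `b` against a tensor product of test functions, as a bilinear form. -/
def LocallySquareIntegrable.pairing {b : ℝ × ℝ → ℝ} (hb : LocallySquareIntegrable b) :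
    testFunctions →ₗ[ℝ] testFunctions →ₗ[ℝ] ℝ :=
  have int := hb.integrable_mul
  LinearMap.mk₂ ℝ (fun φ ψ => ∫ p, b p * tensor φ.1 ψ.1 p)
    (fun φ φ' ψ => by
      rw [← integral_add (int _ _) (int _ _)]; congr 1; funext p; simp [tensor]; ring)
    (fun c φ ψ => by
      rw [smul_eq_mul, ← integral_const_mul]; congr 1; funext p; simp [tensor]; ring)
    (fun φ ψ ψ' => by
      rw [← integral_add (int _ _) (int _ _)]; congr 1; funext p; simp [tensor]; ring)
    (fun c φ ψ => by
      rw [smul_eq_mul, ← integral_const_mul]; congr 1; funext p; simp [tensor]; ring)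

namespace LocallySquareIntegrable

theorem pairing_apply {b : ℝ × ℝ → ℝ} (hb : LocallySquareIntegrable b)
    (φ ψ : testFunctions) :
    hb.pairing φ ψ = ∫ p, b p * tensor φ.1 ψ.1 p := rfl

theorem pairing_haarT {b : ℝ × ℝ → ℝ} (hb : LocallySquareIntegrable b)
    (K L : DyadicInterval) :
    hb.pairing K.haarT L.haarT = haarCoeff b (K, L) := rfl

/-- On `haarSpan` the default value of `mulBy` never occurs, so multiplication by `b` is linear
there. -/
theorem memLp_mul_haarSpan {b : ℝ × ℝ → ℝ} (hb : LocallySquareIntegrable b)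
    {f : L2Plane} (hf : f ∈ haarSpan) :
    MemLp (fun p => b p * f p) 2 volume := by
  induction hf using Submodule.span_induction with
  | mem f hf =>
    obtain ⟨R, rfl⟩ := hf
    refine (memLp_congr_ae ?_).2 (hb.memLp_mul R.1.haarT.2 R.2.haarT.2)
    filter_upwards [coeFn_tens R.1.haarT R.2.haarT] with p hp
    rw [haarL2_eq_tens, hp]
  | zero =>
    refine (memLp_congr_ae ?_).2 (MemLp.zero (ε := ℝ))
    filter_upwards [Lp.coeFn_zero ℝ 2 (volume : Measure (ℝ × ℝ))] with p hp
    rw [hp]; simp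
  | add f g _ _ hf hg =>
    refine (memLp_congr_ae ?_).2 (hf.add hg)
    filter_upwards [Lp.coeFn_add f g] with p hp
    rw [hp]; simp [mul_add]
  | smul c f _ hf =>
    refine (memLp_congr_ae ?_).2 (hf.const_smul c)
    filter_upwards [Lp.coeFn_smul c f] with p hp
    rw [hp]; simp [mul_left_comm]

/-- Multiplication by `b` as a linear map on the span of the Haar functions. -/
def mulLin {b : ℝ × ℝ → ℝ} (hb : LocallySquareIntegrable b) :
    haarSpan →ₗ[ℝ] L2Plane where
  toFun f := mulBy b f
  map_add' f g := by
    have hf := hb.memLp_mul_haarSpan f.2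
    have hg := hb.memLp_mul_haarSpan g.2
    have hfg := hb.memLp_mul_haarSpan (f + g).2
    rw [mulBy, mulBy, mulBy, dif_pos hf, dif_pos hg, dif_pos hfg, ← MemLp.toLp_add,
      MemLp.toLp_eq_toLp_iff]
    filter_upwards [Lp.coeFn_add f.1 g.1] with p hp
    rw [Submodule.coe_add, hp]; simp [mul_add]
  map_smul' c f := by
    have hf := hb.memLp_mul_haarSpan f.2
    have hcf := hb.memLp_mul_haarSpan (c • f).2
    rw [mulBy, mulBy, dif_pos hf, dif_pos hcf, RingHom.id_apply, ← MemLp.toLp_const_smul,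
      MemLp.toLp_eq_toLp_iff]
    filter_upwards [Lp.coeFn_smul c f.1] with p hp
    rw [Submodule.coe_smul, hp]; simp [mul_left_comm]

theorem inner_tens_mulBy {b : ℝ × ℝ → ℝ} (hb : LocallySquareIntegrable b)
    (φ ψ φ' ψ' : testFunctions) (h : tens φ' ψ' ∈ haarSpan) :
    inner ℝ (tens φ ψ) (mulBy b (tens φ' ψ')) = hb.pairing (φ' * φ) (ψ' * ψ) := by
  have hm := hb.memLp_mul_haarSpan h
  rw [inner_tens_eq_integral, mulBy, dif_pos hm, pairing_apply]
  refine integral_congr_ae ?_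
  filter_upwards [hm.coeFn_toLp, coeFn_tens φ' ψ'] with p hp hp'
  rw [hp, hp']; simp only [tensor, testFunctions.coe_mul]; ring

end LocallySquareIntegrable

/-! ### One-variable algebra: products of Haar functions and of their shifts, modulo odd intervals.
-/

namespace DyadicInterval

theorem right_injective : Function.Injective right := fun I K h => by
  simp only [right, DyadicInterval.mk.injEq] at h
  exact DyadicInterval.ext (by omega) (by omega)

theorem left_injective : Function.Injective left := fun I K h => by
  simp only [left, DyadicInterval.mk.injEq] at h
  exact DyadicInterval.ext (by omega) (by omega)

theorem right_ne_left (I K : DyadicInterval) : I.right ≠ K.left := fun h => by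
  simp only [right, left, DyadicInterval.mk.injEq] at h
  omega

theorem IsEven.not_isEven_left {I : DyadicInterval} (h : I.IsEven) : ¬I.left.IsEven := by
  simpa [IsEven, left, Int.even_sub] using h

theorem IsEven.not_isEven_right {I : DyadicInterval} (h : I.IsEven) : ¬I.right.IsEven := by
  simpa [IsEven, right, Int.even_sub] using h

theorem shiftT_of_isEven {I : DyadicInterval} (h : I.IsEven) :
    I.shiftT = I.right.haarT - I.left.haarT := if_pos h

theorem shiftT_of_not_isEven {I : DyadicInterval} (h : ¬I.IsEven) : I.shiftT = 0 := if_neg h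

theorem shiftT_eq_zero {I : DyadicInterval} {x : ℝ} (hx : x ∉ I.toSet) : I.shiftT.1 x = 0 := by
  by_cases h : I.IsEven
  · rw [shiftT_of_isEven h, testFunctions.coe_sub, coe_haarT, coe_haarT,
      haar_eq_zero fun h' => hx (I.right_subset h'), haar_eq_zero fun h' => hx (I.left_subset h'),
      sub_zero]
  · rw [shiftT_of_not_isEven h, testFunctions.coe_zero]

theorem not_subset_left (I : DyadicInterval) : ¬I.toSet ⊆ I.left.toSet := fun h => by
  obtain ⟨x, hx⟩ := I.right.toSet_nonempty
  exact Set.disjoint_left.1 I.disjoint_left_right (h (I.right_subset hx)) hx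

theorem not_subset_right (I : DyadicInterval) : ¬I.toSet ⊆ I.right.toSet := fun h => by
  obtain ⟨x, hx⟩ := I.left.toSet_nonempty
  exact Set.disjoint_left.1 I.disjoint_left_right hx (h (I.left_subset hx))

theorem subset_of_subset_half {I K : DyadicInterval}
    (h : I.toSet ⊆ K.left.toSet ∨ I.toSet ⊆ K.right.toSet) : I.toSet ⊆ K.toSet :=
  h.elim (fun h => h.trans K.left_subset) fun h => h.trans K.right_subset

/-- The Haar function of a strictly larger dyadic interval is constant on `I`. -/
theorem exists_haar_eq_const_of_ne {I P : DyadicInterval} (h : I.toSet ⊆ P.toSet) (hne : I ≠ P) :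
    ∃ c, ∀ x ∈ I.toSet, P.haar x = c := by
  rcases nested_or_disjoint I P with h' | h' | h' | h'
  · exact absurd h' hne
  · obtain ⟨x, hx⟩ := I.toSet_nonempty
    exact absurd (h hx) (Set.disjoint_left.1 h' hx)
  · exact exists_haar_eq_const h'
  · rcases h' with h' | h'
    · exact absurd (h.trans h') I.not_subset_left
    · exact absurd (h.trans h') I.not_subset_right

/-- As `T` halves the scale once, `T h_K` is constant on the even intervals strictly inside `K`. -/
theorem exists_shiftT_eq_const {I K : DyadicInterval} (hI : I.IsEven)
    (h : I.toSet ⊆ K.left.toSet ∨ I.toSet ⊆ K.right.toSet) :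
    ∃ c, ∀ x ∈ I.toSet, K.shiftT.1 x = c := by
  by_cases hK : K.IsEven
  · simp only [shiftT_of_isEven hK, testFunctions.coe_sub, coe_haarT]
    rcases h with h | h
    · obtain ⟨c, hc⟩ := exists_haar_eq_const_of_ne h fun e => hK.not_isEven_left (e ▸ hI)
      exact ⟨0 - c, fun x hx => by
        rw [hc x hx, haar_eq_zero (Set.disjoint_left.1 K.disjoint_left_right (h hx))]⟩
    · obtain ⟨c, hc⟩ := exists_haar_eq_const_of_ne h fun e => hK.not_isEven_right (e ▸ hI)
      exact ⟨c - 0, fun x hx => by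
        rw [hc x hx, haar_eq_zero (Set.disjoint_right.1 K.disjoint_left_right (h hx))]⟩
  · exact ⟨0, fun x _ => by rw [shiftT_of_not_isEven hK, testFunctions.coe_zero]⟩

/-- The span of the Haar functions of the intervals that are not even. -/
def oddSpan : Submodule ℝ testFunctions := Submodule.span ℝ (haarT '' {I | ¬I.IsEven})

theorem shiftT_mem_oddSpan (I : DyadicInterval) : I.shiftT ∈ oddSpan := by
  by_cases h : I.IsEven
  · rw [shiftT_of_isEven h]
    exact sub_mem (Submodule.subset_span ⟨_, h.not_isEven_right, rfl⟩)
      (Submodule.subset_span ⟨_, h.not_isEven_left, rfl⟩)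
  · rw [shiftT_of_not_isEven h]; exact zero_mem _

theorem mul_eq_smul {I : DyadicInterval} {φ ψ : testFunctions} {c : ℝ}
    (hφ : ∀ x ∈ I.toSet, φ.1 x = c) (hψ : ∀ x ∉ I.toSet, ψ.1 x = 0) : φ * ψ = c • ψ := by
  ext x
  rw [testFunctions.coe_mul, testFunctions.coe_smul]
  by_cases hx : x ∈ I.toSet
  · rw [hφ x hx]
  · rw [hψ x hx, mul_zero, mul_zero]

theorem testFunctions_mul_comm (φ ψ : testFunctions) : φ * ψ = ψ * φ :=
  Subtype.ext (mul_comm φ.1 ψ.1)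

/-- For nested distinct even intervals, parity puts the smaller one strictly inside a half of the
larger. There the shift of the larger Haar function is constant, so the product is a multiple of the
shift of the smaller one. For `K = I` this fails: the square is a multiple of an indicator. -/
theorem shiftT_mul_shiftT_mem_oddSpan {I K : DyadicInterval} (hI : I.IsEven) (hne : K ≠ I) :
    K.shiftT * I.shiftT ∈ oddSpan := by
  by_cases hK : K.IsEven
  · rcases nested_or_disjoint K I with h | h | h | h
    · exact absurd h hne
    · have : K.shiftT * I.shiftT = 0 := by
        ext x
        rw [testFunctions.coe_mul, testFunctions.coe_zero]
        by_cases hx : x ∈ K.toSet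
        · rw [shiftT_eq_zero (Set.disjoint_left.1 h hx), mul_zero]
        · rw [shiftT_eq_zero hx, zero_mul]
      rw [this]; exact zero_mem _
    · obtain ⟨c, hc⟩ := exists_shiftT_eq_const hK h
      rw [testFunctions_mul_comm, mul_eq_smul hc fun x => shiftT_eq_zero]
      exact Submodule.smul_mem _ _ K.shiftT_mem_oddSpan
    · obtain ⟨c, hc⟩ := exists_shiftT_eq_const hI h
      rw [mul_eq_smul hc fun x => shiftT_eq_zero]
      exact Submodule.smul_mem _ _ I.shiftT_mem_oddSpan
  · have : K.shiftT * I.shiftT = 0 := by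
      ext x
      rw [shiftT_of_not_isEven hK, testFunctions.coe_mul, testFunctions.coe_zero, zero_mul]
    rw [this]; exact zero_mem _

/-- Both sides are `2|I|⁻¹ 1_I`, since each half has length `|I| / 2`. This exact cancellation
disposes of the diagonal terms. -/
theorem two_smul_haarT_mul_self {I : DyadicInterval} (hI : I.IsEven) :
    (2 : ℝ) • (I.haarT * I.haarT) = I.shiftT * I.shiftT := by
  ext x
  simp only [testFunctions.coe_smul, testFunctions.coe_mul, shiftT_of_isEven hI,
    testFunctions.coe_sub, coe_haarT]
  have h0 : I.right.haar x * I.left.haar x = 0 :=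
    haar_mul_haar_of_disjoint I.disjoint_left_right.symm x
  have hr := I.right.haar_mul_self x
  have hl := I.left.haar_mul_self x
  have hu : I.toSet.indicator (1 : ℝ → ℝ) x
      = I.left.toSet.indicator 1 x + I.right.toSet.indicator 1 x := by
    rw [← I.left_union_right, indicator_union_of_disjoint I.disjoint_left_right]
  rw [length_right, inv_div] at hr
  rw [length_left, inv_div] at hl
  rw [haar_mul_self, hu]
  linear_combination (-1) * hr - hl + 2 * h0

open Classical in
/-- The function `2 h_I h_M` for `M ⊆ I`; integrating against it picks the coefficient of `h_M` in
the product with `2 h_I`. -/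
def localT (I M : DyadicInterval) : testFunctions :=
  if M.toSet ⊆ I.toSet then (2 : ℝ) • (I.haarT * M.haarT) else 0

theorem localT_eq_zero {I : DyadicInterval} (M : DyadicInterval) {x : ℝ} (hx : x ∉ I.toSet) :
    (I.localT M).1 x = 0 := by
  rw [localT]
  split_ifs
  · rw [testFunctions.coe_smul, testFunctions.coe_mul, coe_haarT, haar_eq_zero hx]; ring
  · rfl

/-- This is what a function constant on `I` sees: of all coefficients only that of `h_I` survives,
with factor 2. -/
theorem integral_localT [DecidableEq DyadicInterval] (I M : DyadicInterval) :
    ∫ x, (I.localT M).1 x = if M = I then 2 else 0 := by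
  rw [localT]
  split_ifs with h1 h2 h2
  · simp only [testFunctions.coe_smul, testFunctions.coe_mul, coe_haarT, h2]
    rw [integral_const_mul, integral_haar_mul_self, mul_one]
  · simp only [testFunctions.coe_smul, testFunctions.coe_mul, coe_haarT]
    rw [integral_const_mul, integral_haar_mul_haar_of_ne (Ne.symm h2), mul_zero]
  · exact absurd (h2 ▸ subset_rfl) h1
  · simp

/-- If `h_K h_I` is a multiple of a Haar function `h_N` with `N ⊆ I`, then the functions
`localT I M` recover its expansion. -/
theorem sum_localT_of_mul_eq {I K N : DyadicInterval} {c : ℝ} (hN : N.toSet ⊆ I.toSet)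
    (h : K.haarT * I.haarT = c • N.haarT) {s : Finset DyadicInterval} (hs : N ∈ s) :
    ∑ M ∈ s, (∫ x, K.haarT.1 x * (I.localT M).1 x) • M.haarT = (2 : ℝ) • (K.haarT * I.haarT) := by
  classical
  have hx (x : ℝ) : K.haarT.1 x * I.haarT.1 x = c * N.haar x :=
    congrFun (congrArg Subtype.val h) x
  have key (M : DyadicInterval) : ∫ x, K.haarT.1 x * (I.localT M).1 x
      = if M = N then 2 * c else 0 := by
    rw [localT]
    split_ifs with h1 h2 h2
    · have (x : ℝ) : K.haarT.1 x * ((2 : ℝ) • (I.haarT * M.haarT)).1 x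
          = 2 * c * (N.haar x * M.haar x) := by
        rw [testFunctions.coe_smul, testFunctions.coe_mul, coe_haarT M]
        linear_combination 2 * M.haar x * hx x
      simp only [this]
      rw [integral_const_mul, h2, integral_haar_mul_self, mul_one]
    · have (x : ℝ) : K.haarT.1 x * ((2 : ℝ) • (I.haarT * M.haarT)).1 x
          = 2 * c * (N.haar x * M.haar x) := by
        rw [testFunctions.coe_smul, testFunctions.coe_mul, coe_haarT M]
        linear_combination 2 * M.haar x * hx x
      simp only [this]
      rw [integral_const_mul, integral_haar_mul_haar_of_ne (Ne.symm h2), mul_zero]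
    · exact absurd (h2 ▸ hN) h1
    · simp
  simp only [key, ite_smul, zero_smul]
  rw [Finset.sum_ite_eq' s N, if_pos hs, h, smul_smul]

theorem sum_localT_of_mul_eq_zero {I K : DyadicInterval} (h : K.haarT * I.haarT = 0)
    (s : Finset DyadicInterval) :
    ∑ M ∈ s, (∫ x, K.haarT.1 x * (I.localT M).1 x) • M.haarT = 0 := by
  refine Finset.sum_eq_zero fun M _ => ?_
  have hx (x : ℝ) : K.haarT.1 x * I.haarT.1 x = 0 := congrFun (congrArg Subtype.val h) x
  have (x : ℝ) : K.haarT.1 x * (I.localT M).1 x = 0 := by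
    rw [localT]
    split_ifs
    · rw [testFunctions.coe_smul, testFunctions.coe_mul]
      linear_combination 2 * M.haarT.1 x * hx x
    · simp
  simp [this]

/-- For `M ⊆ I` the function `h_I²` is constant on `M`, which leaves a multiple of `∫ h_M = 0`. This
matches the vanishing of the symbol at `K = I`. -/
theorem sum_localT_self (I : DyadicInterval) (s : Finset DyadicInterval) :
    ∑ M ∈ s, (∫ x, I.haarT.1 x * (I.localT M).1 x) • M.haarT = 0 := by
  refine Finset.sum_eq_zero fun M _ => ?_
  have : ∫ x, I.haarT.1 x * (I.localT M).1 x = 0 := by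
    rw [localT]
    split_ifs with h
    · have (x : ℝ) : I.haarT.1 x * ((2 : ℝ) • (I.haarT * M.haarT)).1 x
          = 2 * I.length⁻¹ * M.haar x := by
        rw [testFunctions.coe_smul, testFunctions.coe_mul, coe_haarT, coe_haarT]
        by_cases hx : x ∈ M.toSet
        · have := I.haar_mul_self x
          rw [indicator_of_mem (h hx), Pi.one_apply, mul_one] at this
          rw [← this]; ring
        · rw [haar_eq_zero hx]; ring
      simp only [this]
      rw [integral_const_mul, integral_haar, mul_zero]
    · simp
  rw [this, zero_smul]

/-- Modulo Haar functions of odd intervals, `2 h_K h_I - (T h_K) (T h_I)` is the part of the Haar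
expansion of `2 h_K h_I` on the intervals `M ⊆ I`. -/
theorem commutator_symbol_mem_oddSpan {I K : DyadicInterval} (hI : I.IsEven)
    {s : Finset DyadicInterval} (hIs : I ∈ s) (hKs : K ∈ s) :
    (2 : ℝ) • (K.haarT * I.haarT) - K.shiftT * I.shiftT
      - ∑ M ∈ s, (∫ x, K.haarT.1 x * (I.localT M).1 x) • M.haarT ∈ oddSpan := by
  by_cases hne : K = I
  · subst hne
    rw [sum_localT_self, two_smul_haarT_mul_self hI, sub_self, sub_zero]
    exact zero_mem _
  have hsum : ∑ M ∈ s, (∫ x, K.haarT.1 x * (I.localT M).1 x) • M.haarT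
      = (2 : ℝ) • (K.haarT * I.haarT) := by
    rcases nested_or_disjoint K I with h | h | h | h
    · exact absurd h hne
    · have h0 : K.haarT * I.haarT = 0 := by
        ext x
        exact haar_mul_haar_of_disjoint h x
      rw [sum_localT_of_mul_eq_zero h0, h0, smul_zero]
    · obtain ⟨c, hc⟩ := exists_haar_eq_const h
      refine sum_localT_of_mul_eq (c := c) (subset_of_subset_half h) ?_ hKs
      rw [testFunctions_mul_comm]
      exact mul_eq_smul hc fun x => haar_eq_zero
    · obtain ⟨c, hc⟩ := exists_haar_eq_const h
      exact sum_localT_of_mul_eq (c := c) subset_rfl (mul_eq_smul hc fun x => haar_eq_zero) hIs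
  rw [hsum, sub_sub_cancel_left]
  exact neg_mem (shiftT_mul_shiftT_mem_oddSpan hI hne)

end DyadicInterval

/-! ### The shifts on `L²(ℝ²)`: convergence, linearity, and `T* T = 2` on even intervals. -/

theorem orthonormal_haarL2 : Orthonormal ℝ haarL2 := by
  classical
  rw [orthonormal_iff_ite]
  intro R S
  rw [haarL2_eq_tens, haarL2_eq_tens, inner_tens_tens]
  simp only [DyadicInterval.coe_haarT]
  rw [DyadicInterval.integral_haar_mul_haar, DyadicInterval.integral_haar_mul_haar]
  by_cases h1 : R.1 = S.1 <;> by_cases h2 : R.2 = S.2 <;> simp [h1, h2, Prod.ext_iff]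

/-- Distinct intervals have no half in common, and no right half is a left half. The value 2 counts
the two orthonormal halves. -/
theorem inner_shiftHaar₁ [DecidableEq DyadicRectangle] {R : DyadicRectangle} (hR : R.1.IsEven)
    (S : DyadicRectangle) :
    inner ℝ (shiftHaar₁ R) (shiftHaar₁ S) = if S = R then (2 : ℝ) else 0 := by
  classical
  have ho := orthonormal_iff_ite.1 orthonormal_haarL2
  by_cases hS : S.1.IsEven
  · simp only [shiftHaar₁, if_pos hR, if_pos hS, inner_sub_left, inner_sub_right, ho, Prod.mk.injEq,
      DyadicInterval.right_injective.eq_iff, DyadicInterval.left_injective.eq_iff,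
      DyadicInterval.right_ne_left, (DyadicInterval.right_ne_left _ _).symm, false_and, if_false,
      ← Prod.ext_iff, eq_comm (a := S)]
    split_ifs <;> norm_num
  · rw [shiftHaar₁, shiftHaar₁, if_neg hS, inner_zero_right, if_neg]
    rintro rfl
    exact hS hR

theorem inner_shiftHaar₂ [DecidableEq DyadicRectangle] {R : DyadicRectangle} (hR : R.2.IsEven)
    (S : DyadicRectangle) :
    inner ℝ (shiftHaar₂ R) (shiftHaar₂ S) = if S = R then (2 : ℝ) else 0 := by
  classical
  have ho := orthonormal_iff_ite.1 orthonormal_haarL2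
  by_cases hS : S.2.IsEven
  · simp only [shiftHaar₂, if_pos hR, if_pos hS, inner_sub_left, inner_sub_right, ho, Prod.mk.injEq,
      DyadicInterval.right_injective.eq_iff, DyadicInterval.left_injective.eq_iff,
      DyadicInterval.right_ne_left, (DyadicInterval.right_ne_left _ _).symm, and_false, if_false,
      ← Prod.ext_iff, eq_comm (a := S)]
    split_ifs <;> norm_num
  · rw [shiftHaar₂, shiftHaar₂, if_neg hS, inner_zero_right, if_neg]
    rintro rfl
    exact hS hR

/-- A series with the coefficients of an orthonormal system against an orthogonal system of bounded
norms converges. -/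
theorem summable_inner_smul {ι E : Type*} [NormedAddCommGroup E] [InnerProductSpace ℝ E]
    [CompleteSpace E] {e v : ι → E} (he : Orthonormal ℝ e)
    (hv : ∀ i j, i ≠ j → inner ℝ (v i) (v j) = 0) {C : ℝ} (hC : ∀ i, ‖v i‖ ^ 2 ≤ C) (f : E) :
    Summable fun i => inner ℝ (e i) f • v i := by
  have hV : OrthogonalFamily ℝ (fun i => Submodule.span ℝ {v i})
      fun i => (Submodule.span ℝ {v i}).subtypeₗᵢ := by
    intro i j hij x y
    obtain ⟨a, ha⟩ := Submodule.mem_span_singleton.1 x.2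
    obtain ⟨c, hc⟩ := Submodule.mem_span_singleton.1 y.2
    rw [Submodule.coe_subtypeₗᵢ, Submodule.coe_subtypeₗᵢ, Submodule.subtype_apply,
      Submodule.subtype_apply, ← ha, ← hc, inner_smul_left, inner_smul_right, hv i j hij]
    simp
  refine (hV.summable_iff_norm_sq_summable fun i =>
    ⟨inner ℝ (e i) f • v i, Submodule.smul_mem _ _ (Submodule.mem_span_singleton_self _)⟩).2 ?_
  refine Summable.of_nonneg_of_le (fun _ => sq_nonneg _) (fun i => ?_)
    ((he.inner_products_summable f).mul_right C)
  rw [Submodule.coe_norm, norm_smul, mul_pow]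
  exact mul_le_mul_of_nonneg_left (hC i) (sq_nonneg _)

/-- Convergence ensures that the `tsum` defining `shift₁` is a genuine sum, which linearity
requires. -/
theorem summable_shift₁ (f : L2Plane) : Summable fun R => inner ℝ (haarL2 R) f • shiftHaar₁ R := by
  classical
  refine summable_inner_smul (C := 2) orthonormal_haarL2 (fun R S h => ?_) (fun R => ?_) f
  · by_cases hR : R.1.IsEven
    · rw [inner_shiftHaar₁ hR, if_neg h.symm]
    · rw [shiftHaar₁, if_neg hR, inner_zero_left]
  · by_cases hR : R.1.IsEven
    · rw [← real_inner_self_eq_norm_sq, inner_shiftHaar₁ hR, if_pos rfl]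
    · simp [shiftHaar₁, if_neg hR]

theorem summable_shift₂ (f : L2Plane) : Summable fun R => inner ℝ (haarL2 R) f • shiftHaar₂ R := by
  classical
  refine summable_inner_smul (C := 2) orthonormal_haarL2 (fun R S h => ?_) (fun R => ?_) f
  · by_cases hR : R.2.IsEven
    · rw [inner_shiftHaar₂ hR, if_neg h.symm]
    · rw [shiftHaar₂, if_neg hR, inner_zero_left]
  · by_cases hR : R.2.IsEven
    · rw [← real_inner_self_eq_norm_sq, inner_shiftHaar₂ hR, if_pos rfl]
    · simp [shiftHaar₂, if_neg hR]

/-- The shift `T₁` as a linear map. -/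
def shiftLin₁ : L2Plane →ₗ[ℝ] L2Plane where
  toFun := shift₁
  map_add' f g := by
    simp only [shift₁, inner_add_right, add_smul]
    exact (summable_shift₁ f).tsum_add (summable_shift₁ g)
  map_smul' c f := by
    simp only [shift₁, inner_smul_right, mul_smul, RingHom.id_apply]
    exact (summable_shift₁ f).tsum_const_smul c

/-- The shift `T₂` as a linear map. -/
def shiftLin₂ : L2Plane →ₗ[ℝ] L2Plane where
  toFun := shift₂
  map_add' f g := by
    simp only [shift₂, inner_add_right, add_smul]
    exact (summable_shift₂ f).tsum_add (summable_shift₂ g)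
  map_smul' c f := by
    simp only [shift₂, inner_smul_right, mul_smul, RingHom.id_apply]
    exact (summable_shift₂ f).tsum_const_smul c

theorem shift₁_haarL2 (R : DyadicRectangle) : shift₁ (haarL2 R) = shiftHaar₁ R := by
  classical
  simp only [shift₁, orthonormal_iff_ite.1 orthonormal_haarL2, ite_smul, one_smul, zero_smul]
  exact tsum_ite_eq R _

theorem shift₂_haarL2 (R : DyadicRectangle) : shift₂ (haarL2 R) = shiftHaar₂ R := by
  classical
  simp only [shift₂, orthonormal_iff_ite.1 orthonormal_haarL2, ite_smul, one_smul, zero_smul]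
  exact tsum_ite_eq R _

/-- `T₁* T₁ = 2` on the even part. -/
theorem inner_shiftHaar₁_shift₁ {R : DyadicRectangle} (hR : R.1.IsEven) (f : L2Plane) :
    inner ℝ (shiftHaar₁ R) (shift₁ f) = 2 * inner ℝ (haarL2 R) f := by
  classical
  rw [shift₁, ← innerSL_apply_apply ℝ, (innerSL ℝ (shiftHaar₁ R)).map_tsum (summable_shift₁ f)]
  simp only [innerSL_apply_apply, inner_smul_right, inner_shiftHaar₁ hR, mul_ite, mul_zero]
  rw [tsum_ite_eq, mul_comm]

/-- `T₂* T₂ = 2` on the even part. -/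
theorem inner_shiftHaar₂_shift₂ {R : DyadicRectangle} (hR : R.2.IsEven) (f : L2Plane) :
    inner ℝ (shiftHaar₂ R) (shift₂ f) = 2 * inner ℝ (haarL2 R) f := by
  classical
  rw [shift₂, ← innerSL_apply_apply ℝ, (innerSL ℝ (shiftHaar₂ R)).map_tsum (summable_shift₂ f)]
  simp only [innerSL_apply_apply, inner_smul_right, inner_shiftHaar₂ hR, mul_ite, mul_zero]
  rw [tsum_ite_eq, mul_comm]

theorem haarL2_mem_haarSpan (R : DyadicRectangle) : haarL2 R ∈ haarSpan :=
  Submodule.subset_span (mem_range_self R)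

theorem shiftHaar₁_mem_haarSpan (R : DyadicRectangle) : shiftHaar₁ R ∈ haarSpan := by
  rw [shiftHaar₁]
  split_ifs
  · exact sub_mem (haarL2_mem_haarSpan _) (haarL2_mem_haarSpan _)
  · exact zero_mem _

theorem shiftHaar₂_mem_haarSpan (R : DyadicRectangle) : shiftHaar₂ R ∈ haarSpan := by
  rw [shiftHaar₂]
  split_ifs
  · exact sub_mem (haarL2_mem_haarSpan _) (haarL2_mem_haarSpan _)
  · exact zero_mem _

theorem shiftLin₁_mem_haarSpan : ∀ f ∈ haarSpan, shiftLin₁ f ∈ haarSpan := by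
  have : haarSpan ≤ haarSpan.comap shiftLin₁ := Submodule.span_le.2 <| by
    rintro _ ⟨R, rfl⟩
    change shift₁ (haarL2 R) ∈ haarSpan
    rw [shift₁_haarL2]
    exact shiftHaar₁_mem_haarSpan R
  exact this

theorem shiftLin₂_mem_haarSpan : ∀ f ∈ haarSpan, shiftLin₂ f ∈ haarSpan := by
  have : haarSpan ≤ haarSpan.comap shiftLin₂ := Submodule.span_le.2 <| by
    rintro _ ⟨R, rfl⟩
    change shift₂ (haarL2 R) ∈ haarSpan
    rw [shift₂_haarL2]
    exact shiftHaar₂_mem_haarSpan R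
  exact this

/-! ### The vectors `T₁T₂ h_R` and the matrix of the repeated commutator against them. -/

/-- The function `T₁ T₂ h_R`. -/
def shiftHaar₁₂ (R : DyadicRectangle) : L2Plane := tens R.1.shiftT R.2.shiftT

theorem shiftHaar₁₂_eq_sub₁ {R : DyadicRectangle} (h : R.2.IsEven) :
    shiftHaar₁₂ R = shiftHaar₁ (R.1, R.2.right) - shiftHaar₁ (R.1, R.2.left) := by
  rw [shiftHaar₁₂, shiftHaar₁_eq_tens, shiftHaar₁_eq_tens, DyadicInterval.shiftT_of_isEven h,
    map_sub]

theorem shiftHaar₁₂_eq_sub₂ {R : DyadicRectangle} (h : R.1.IsEven) :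
    shiftHaar₁₂ R = shiftHaar₂ (R.1.right, R.2) - shiftHaar₂ (R.1.left, R.2) := by
  rw [shiftHaar₁₂, shiftHaar₂_eq_tens, shiftHaar₂_eq_tens, DyadicInterval.shiftT_of_isEven h,
    map_sub, LinearMap.sub_apply]

theorem shift₁_shiftHaar₂ (R : DyadicRectangle) : shift₁ (shiftHaar₂ R) = shiftHaar₁₂ R := by
  by_cases h : R.2.IsEven
  · rw [shiftHaar₁₂_eq_sub₁ h, shiftHaar₂, if_pos h, ← shift₁_haarL2, ← shift₁_haarL2]
    exact shiftLin₁.map_sub _ _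
  · rw [shiftHaar₂, if_neg h, shiftHaar₁₂, DyadicInterval.shiftT_of_not_isEven h, map_zero]
    exact shiftLin₁.map_zero

theorem inner_shiftHaar₁₂_shift₁ {R : DyadicRectangle} (h₁ : R.1.IsEven) (h₂ : R.2.IsEven)
    (f : L2Plane) : inner ℝ (shiftHaar₁₂ R) (shift₁ f) = 2 * inner ℝ (shiftHaar₂ R) f := by
  rw [shiftHaar₁₂_eq_sub₁ h₂, inner_sub_left, inner_shiftHaar₁_shift₁ (R := (R.1, R.2.right)) h₁,
    inner_shiftHaar₁_shift₁ (R := (R.1, R.2.left)) h₁, shiftHaar₂, if_pos h₂, inner_sub_left, mul_sub]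

theorem inner_shiftHaar₁₂_shift₂ {R : DyadicRectangle} (h₁ : R.1.IsEven) (h₂ : R.2.IsEven)
    (f : L2Plane) : inner ℝ (shiftHaar₁₂ R) (shift₂ f) = 2 * inner ℝ (shiftHaar₁ R) f := by
  rw [shiftHaar₁₂_eq_sub₂ h₁, inner_sub_left, inner_shiftHaar₂_shift₂ (R := (R.1.right, R.2)) h₂,
    inner_shiftHaar₂_shift₂ (R := (R.1.left, R.2)) h₂, shiftHaar₁, if_pos h₁, inner_sub_left, mul_sub]

theorem inner_shiftHaar₁₂_self [DecidableEq DyadicRectangle] {R : DyadicRectangle}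
    (h₁ : R.1.IsEven) (h₂ : R.2.IsEven) (S : DyadicRectangle) :
    inner ℝ (shiftHaar₁₂ R) (shiftHaar₁₂ S) = if S = R then (4 : ℝ) else 0 := by
  classical
  have e : shiftHaar₁₂ S = shift₁ (shiftHaar₂ S) := (shift₁_shiftHaar₂ S).symm
  rw [e, inner_shiftHaar₁₂_shift₁ h₁ h₂, inner_shiftHaar₂ h₂]
  split_ifs <;> norm_num

/-- Each shift standing to the left of `b` is cancelled against one in `T₁T₂ h_R`, at the price of a
factor 2. Only products with `b` remain. -/
theorem inner_shiftHaar₁₂_repeatedComm (b : ℝ × ℝ → ℝ) {R : DyadicRectangle} (h₁ : R.1.IsEven)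
    (h₂ : R.2.IsEven) (f : L2Plane) :
    inner ℝ (shiftHaar₁₂ R) (repeatedComm b f)
      = 4 * inner ℝ (haarL2 R) (mulBy b f) - 2 * inner ℝ (shiftHaar₁ R) (mulBy b (shift₁ f))
        - 2 * inner ℝ (shiftHaar₂ R) (mulBy b (shift₂ f))
        + inner ℝ (shiftHaar₁₂ R) (mulBy b (shift₁ (shift₂ f))) := by
  simp only [repeatedComm, comm]
  rw [inner_sub_right, inner_sub_right, inner_shiftHaar₁₂_shift₂ h₁ h₂, inner_sub_right,
    inner_shiftHaar₁_shift₁ h₁, inner_shiftHaar₁₂_shift₁ h₁ h₂]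
  ring

/-- The function `2 h_K h_I - (T h_K) (T h_I)`, the symbol of the matrix of `[T, ·]` after
composition with `T*`. -/
def DyadicInterval.symbolT (I K : DyadicInterval) : testFunctions :=
  (2 : ℝ) • (K.haarT * I.haarT) - K.shiftT * I.shiftT

namespace LocallySquareIntegrable

/-- The repeated commutator as a linear map on the span of the Haar functions. -/
def commLin {b : ℝ × ℝ → ℝ} (hb : LocallySquareIntegrable b) : haarSpan →ₗ[ℝ] L2Plane :=
  let C := shiftLin₁ ∘ₗ hb.mulLin - hb.mulLin ∘ₗ shiftLin₁.restrict shiftLin₁_mem_haarSpan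
  shiftLin₂ ∘ₗ C - C ∘ₗ shiftLin₂.restrict shiftLin₂_mem_haarSpan

theorem commLin_apply {b : ℝ × ℝ → ℝ} (hb : LocallySquareIntegrable b) (f : haarSpan) :
    hb.commLin f = repeatedComm b f := rfl

/-- The four terms are the expansion of a product of two differences, one in each variable. The
memberships in `haarSpan` rule out the default value of `mulBy`. -/
theorem inner_shiftHaar₁₂_repeatedComm_haarL2 {b : ℝ × ℝ → ℝ} (hb : LocallySquareIntegrable b)
    {R : DyadicRectangle} (h₁ : R.1.IsEven) (h₂ : R.2.IsEven) (S : DyadicRectangle) :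
    inner ℝ (shiftHaar₁₂ R) (repeatedComm b (haarL2 S))
      = hb.pairing (R.1.symbolT S.1) (R.2.symbolT S.2) := by
  have m₁ := shiftHaar₁_mem_haarSpan S
  have m₂ := shiftHaar₂_mem_haarSpan S
  have m₁₂ : shiftHaar₁₂ S ∈ haarSpan := by
    rw [← shift₁_shiftHaar₂]; exact shiftLin₁_mem_haarSpan _ m₂
  have m := haarL2_mem_haarSpan S
  rw [inner_shiftHaar₁₂_repeatedComm b h₁ h₂, shift₂_haarL2, shift₁_shiftHaar₂, shift₁_haarL2]
  rw [shiftHaar₁_eq_tens] at m₁ ⊢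
  rw [shiftHaar₂_eq_tens] at m₂ ⊢
  rw [shiftHaar₁₂] at m₁₂
  rw [haarL2_eq_tens] at m
  rw [haarL2_eq_tens, haarL2_eq_tens, shiftHaar₁_eq_tens, shiftHaar₂_eq_tens, shiftHaar₁₂,
    shiftHaar₁₂, hb.inner_tens_mulBy _ _ _ _ m, hb.inner_tens_mulBy _ _ _ _ m₁,
    hb.inner_tens_mulBy _ _ _ _ m₂, hb.inner_tens_mulBy _ _ _ _ m₁₂]
  simp only [DyadicInterval.symbolT, map_sub, map_smul, LinearMap.sub_apply, LinearMap.smul_apply,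
    smul_eq_mul]
  ring

/-- `SkipsScales` only concerns Haar coefficients, so the other factor has to be a Haar combination
as well. -/
theorem pairing_eq_zero_left {b : ℝ × ℝ → ℝ} (hb : LocallySquareIntegrable b)
    (hs : SkipsScales b) {φ ψ : testFunctions} (hφ : φ ∈ DyadicInterval.oddSpan)
    (hψ : ψ ∈ Submodule.span ℝ (range DyadicInterval.haarT)) : hb.pairing φ ψ = 0 := by
  have h1 : Submodule.span ℝ (range DyadicInterval.haarT) ≤ LinearMap.ker (hb.pairing φ) := by
    refine Submodule.span_le.2 ?_
    rintro _ ⟨L, rfl⟩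
    have h2 : DyadicInterval.oddSpan ≤ LinearMap.ker (hb.pairing.flip L.haarT) := by
      refine Submodule.span_le.2 ?_
      rintro _ ⟨K, hK, rfl⟩
      by_contra h
      exact hK (hs (K, L) h).1
    exact h2 hφ
  exact h1 hψ

theorem pairing_eq_zero_right {b : ℝ × ℝ → ℝ} (hb : LocallySquareIntegrable b)
    (hs : SkipsScales b) {φ ψ : testFunctions} (hψ : ψ ∈ DyadicInterval.oddSpan)
    (hφ : φ ∈ Submodule.span ℝ (range DyadicInterval.haarT)) : hb.pairing φ ψ = 0 := by
  have h1 : Submodule.span ℝ (range DyadicInterval.haarT) ≤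
      LinearMap.ker (hb.pairing.flip ψ) := by
    refine Submodule.span_le.2 ?_
    rintro _ ⟨L, rfl⟩
    have h2 : DyadicInterval.oddSpan ≤ LinearMap.ker (hb.pairing L.haarT) := by
      refine Submodule.span_le.2 ?_
      rintro _ ⟨K, hK, rfl⟩
      by_contra h
      exact hK (hs (L, K) h).2
    exact h2 hψ
  exact h1 hφ

/-- Each symbol is its localized Haar expansion plus an odd remainder. Both pieces lie in the Haar
span, although `h_I²` alone does not, so the remainders can be dropped one variable at a time. -/
theorem pairing_symbolT {b : ℝ × ℝ → ℝ} (hb : LocallySquareIntegrable b) (hs : SkipsScales b)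
    {R : DyadicRectangle} (h₁ : R.1.IsEven) (h₂ : R.2.IsEven) {S : DyadicRectangle}
    {s t : Finset DyadicInterval} (hRs : R.1 ∈ s) (hSs : S.1 ∈ s) (hRt : R.2 ∈ t)
    (hSt : S.2 ∈ t) :
    hb.pairing (R.1.symbolT S.1) (R.2.symbolT S.2)
      = ∑ M ∈ s, ∑ N ∈ t, haarCoeff b (M, N)
        * inner ℝ (tens (R.1.localT M) (R.2.localT N)) (haarL2 S) := by
  have o₁ := DyadicInterval.commutator_symbol_mem_oddSpan h₁ hRs hSs
  have o₂ := DyadicInterval.commutator_symbol_mem_oddSpan h₂ hRt hSt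
  set u : testFunctions := ∑ M ∈ s, (∫ x, S.1.haarT.1 x * (R.1.localT M).1 x) • M.haarT with hu
  set v : testFunctions := ∑ N ∈ t, (∫ x, S.2.haarT.1 x * (R.2.localT N).1 x) • N.haarT with hv
  have odd_le : DyadicInterval.oddSpan ≤ Submodule.span ℝ (range DyadicInterval.haarT) :=
    Submodule.span_mono (image_subset_range _ _)
  have mem_span (K : DyadicInterval) : K.haarT ∈ Submodule.span ℝ (range DyadicInterval.haarT) :=
    Submodule.subset_span (mem_range_self K)
  have u_mem : u ∈ Submodule.span ℝ (range DyadicInterval.haarT) :=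
    sum_mem fun M _ => Submodule.smul_mem _ _ (mem_span M)
  have v_mem : v ∈ Submodule.span ℝ (range DyadicInterval.haarT) :=
    sum_mem fun M _ => Submodule.smul_mem _ _ (mem_span M)
  have key : hb.pairing (R.1.symbolT S.1) (R.2.symbolT S.2) = hb.pairing u v := by
    have e₁ : R.1.symbolT S.1 = u + (R.1.symbolT S.1 - u) := by abel
    have e₂ : R.2.symbolT S.2 = v + (R.2.symbolT S.2 - v) := by abel
    have z₁ : hb.pairing (R.1.symbolT S.1 - u) (v + (R.2.symbolT S.2 - v)) = 0 :=
      hb.pairing_eq_zero_left hs o₁ (add_mem v_mem (odd_le o₂))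
    have z₂ : hb.pairing u (R.2.symbolT S.2 - v) = 0 := hb.pairing_eq_zero_right hs o₂ u_mem
    rw [e₁, e₂, map_add hb.pairing, LinearMap.add_apply, z₁, map_add (hb.pairing u), z₂, add_zero,
      add_zero]
  rw [key, hu, map_sum hb.pairing, LinearMap.sum_apply]
  refine Finset.sum_congr rfl fun M _ => ?_
  rw [hv, map_sum (hb.pairing _)]
  refine Finset.sum_congr rfl fun N _ => ?_
  rw [map_smul (hb.pairing _), map_smul hb.pairing, LinearMap.smul_apply, pairing_haarT, haarL2_eq_tens, real_inner_comm,
    inner_tens_tens, smul_eq_mul, smul_eq_mul]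
  ring

/-- Testing the commutator on a function that is constant on `R` isolates the coefficient
`(b, h_R)`. -/
theorem inner_shiftHaar₁₂_repeatedComm_of_const {b : ℝ × ℝ → ℝ} (hb : LocallySquareIntegrable b)
    (hs : SkipsScales b) {R : DyadicRectangle} (h₁ : R.1.IsEven) (h₂ : R.2.IsEven) {f : L2Plane}
    (hf : f ∈ haarSpan) {c : ℝ} (hc : ∀ᵐ p, p ∈ DyadicRectangle.toSet R → f p = c) :
    inner ℝ (shiftHaar₁₂ R) (repeatedComm b f) = 4 * c * haarCoeff b R := by
  classical
  obtain ⟨a, ha⟩ := Finsupp.mem_span_range_iff_exists_finsupp.1 hf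
  -- The same finite index sets must serve every `h_S` in the expansion of `f`, as well as `R`
  -- itself.
  set s := insert R.1 (a.support.image Prod.fst)
  set t := insert R.2 (a.support.image Prod.snd)
  have hfsum : (⟨f, hf⟩ : haarSpan)
      = ∑ S ∈ a.support, a S • (⟨haarL2 S, haarL2_mem_haarSpan S⟩ : haarSpan) := by
    apply Subtype.ext
    rw [Submodule.coe_sum]
    exact ha.symm
  have e : inner ℝ (shiftHaar₁₂ R) (repeatedComm b f)
      = ∑ M ∈ s, ∑ N ∈ t, haarCoeff b (M, N)
        * inner ℝ (tens (R.1.localT M) (R.2.localT N)) f := by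
    rw [show repeatedComm b f = hb.commLin ⟨f, hf⟩ from rfl, hfsum, map_sum, inner_sum]
    have step (S) (hS : S ∈ a.support) :
        inner ℝ (shiftHaar₁₂ R) (hb.commLin (a S • ⟨haarL2 S, haarL2_mem_haarSpan S⟩))
        = ∑ M ∈ s, ∑ N ∈ t, haarCoeff b (M, N)
          * inner ℝ (tens (R.1.localT M) (R.2.localT N)) (a S • haarL2 S) := by
      rw [map_smul, inner_smul_right, commLin_apply,
        hb.inner_shiftHaar₁₂_repeatedComm_haarL2 h₁ h₂,
        hb.pairing_symbolT hs h₁ h₂ (s := s) (t := t) (Finset.mem_insert_self _ _)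
          (Finset.mem_insert_of_mem (Finset.mem_image_of_mem _ hS)) (Finset.mem_insert_self _ _)
          (Finset.mem_insert_of_mem (Finset.mem_image_of_mem _ hS)), Finset.mul_sum]
      refine Finset.sum_congr rfl fun M _ => ?_
      rw [Finset.mul_sum]
      refine Finset.sum_congr rfl fun N _ => ?_
      rw [inner_smul_right]; ring
    rw [Finset.sum_congr rfl step, Finset.sum_comm]
    refine Finset.sum_congr rfl fun M _ => ?_
    rw [Finset.sum_comm]
    refine Finset.sum_congr rfl fun N _ => ?_
    rw [← ha, Finsupp.sum, inner_sum, Finset.mul_sum]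
  have hin (M N : DyadicInterval) : inner ℝ (tens (R.1.localT M) (R.2.localT N)) f
      = c * ((if M = R.1 then 2 else 0) * if N = R.2 then 2 else 0) := by
    rw [← DyadicInterval.integral_localT, ← DyadicInterval.integral_localT, ← integral_prod_mul,
      ← integral_const_mul, inner_tens_eq_integral]
    refine integral_congr_ae ?_
    filter_upwards [hc] with p hp
    by_cases hpR : p ∈ DyadicRectangle.toSet R
    · rw [hp hpR, tensor]
    · have : (R.1.localT M).1 p.1 * (R.2.localT N).1 p.2 = 0 := by
        rw [DyadicRectangle.toSet, mem_prod, not_and_or] at hpR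
        rcases hpR with h | h
        · rw [DyadicInterval.localT_eq_zero M h, zero_mul]
        · rw [DyadicInterval.localT_eq_zero N h, mul_zero]
      rw [tensor, this, mul_zero, mul_zero]
  -- Only `(M, N) = R` survives; the factor 4 is one 2 from each variable.
  rw [e, Finset.sum_eq_single_of_mem R.1 (Finset.mem_insert_self _ _),
    Finset.sum_eq_single_of_mem R.2 (Finset.mem_insert_self _ _), hin, if_pos rfl, if_pos rfl]
  · ring
  · intro N _ hN
    rw [hin, if_neg hN]; ring
  · intro M _ hM
    refine Finset.sum_eq_zero fun N _ => ?_
    rw [hin, if_neg hM]; ring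

/-- The lower bound for the norm of the commutator by a single test function. -/
theorem sum_haarCoeff_sq_le {b : ℝ × ℝ → ℝ} (hb : LocallySquareIntegrable b)
    (hs : SkipsScales b) {f : L2Plane} (hf : f ∈ haarSpan) {c : ℝ} (F : Finset DyadicRectangle)
    (hc : ∀ R ∈ F, ∀ᵐ p, p ∈ DyadicRectangle.toSet R → f p = c) :
    4 * c ^ 2 * ∑ R ∈ F, haarCoeff b R ^ 2 ≤ ‖repeatedComm b f‖ ^ 2 := by
  classical
  have ho : Orthonormal ℝ fun R : {R : DyadicRectangle // R.1.IsEven ∧ R.2.IsEven} =>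
      (2 : ℝ)⁻¹ • shiftHaar₁₂ R.1 := by
    rw [orthonormal_iff_ite]
    intro R S
    rw [inner_smul_left, inner_smul_right, inner_shiftHaar₁₂_self R.2.1 R.2.2]
    by_cases h : S = R
    · rw [if_pos (congrArg _ h), if_pos h.symm]; norm_num
    · rw [if_neg fun h' => h (Subtype.ext h'), if_neg fun h' => h h'.symm]; norm_num
  -- Bessel's inequality, with coefficients `2c (b, h_R)`. Rectangles of `F` that are not (even,
  -- even) contribute nothing.
  refine le_trans (le_of_eq ?_) (ho.sum_inner_products_le (repeatedComm b f)
    (s := F.subtype fun R => R.1.IsEven ∧ R.2.IsEven))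
  have hF : ∑ R ∈ F, haarCoeff b R ^ 2
      = ∑ R ∈ F with R.1.IsEven ∧ R.2.IsEven, haarCoeff b R ^ 2 := by
    refine (Finset.sum_filter_of_ne fun R _ h => hs R fun h' => h ?_).symm
    rw [h']; norm_num
  rw [hF, ← Finset.sum_subtype_eq_sum_filter, Finset.mul_sum]
  refine Finset.sum_congr rfl fun R hR => ?_
  rw [Finset.mem_subtype] at hR
  rw [inner_smul_left, hb.inner_shiftHaar₁₂_repeatedComm_of_const hs R.2.1 R.2.2 hf (hc _ hR),
    Real.norm_eq_abs, sq_abs]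
  simp
  ring

end LocallySquareIntegrable

/-! ### A finite Haar combination equal to one on a given dyadic open set. -/

namespace DyadicInterval

open Classical in
theorem ind_apply (m a : ℤ) (x : ℝ) :
    (ind ⟨m, a⟩).1 x = if ⌊x / (2 : ℝ) ^ m⌋ = a then 1 else 0 := by
  rw [coe_ind, indicator_apply]
  simp only [mem_toSet_iff, Pi.one_apply]

theorem ind_left_add_ind_right (I : DyadicInterval) : I.left.ind + I.right.ind = I.ind := by
  ext x
  rw [testFunctions.coe_add, coe_ind, coe_ind, coe_ind, ← I.left_union_right,
    indicator_union_of_disjoint I.disjoint_left_right]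

/-- The span of the Haar functions of dyadic intervals. -/
def haarSpanT : Submodule ℝ testFunctions := Submodule.span ℝ (range haarT)

theorem ind_right_sub_ind_left_mem (I : DyadicInterval) : I.right.ind - I.left.ind ∈ haarSpanT := by
  have : I.right.ind - I.left.ind = √I.length • I.haarT := by
    rw [haarT, smul_smul, mul_inv_cancel₀ (Real.sqrt_pos.2 I.length_pos).ne', one_smul]
  rw [this]
  exact Submodule.smul_mem _ _ (Submodule.subset_span (mem_range_self I))

/-- With `P` the parent, the difference is `½ (1_{P₊} - 1_{P₋})` up to sign, the sign being decided
by the parity of `a`. -/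
theorem ind_sub_half_ind_parent_mem (m a : ℤ) :
    ind ⟨m, a⟩ - (2 : ℝ)⁻¹ • ind ⟨m + 1, a / 2⟩ ∈ haarSpanT := by
  set P : DyadicInterval := ⟨m + 1, a / 2⟩ with hP
  have hmem := Submodule.smul_mem _ (2 : ℝ)⁻¹ P.ind_right_sub_ind_left_mem
  rw [← ind_left_add_ind_right P]
  rcases Int.emod_two_eq_zero_or_one a with h | h
  · have e : (⟨m, a⟩ : DyadicInterval) = P.left :=
      DyadicInterval.ext (by simp [hP, left]) (by simp only [hP, left]; omega)
    rw [e]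
    convert neg_mem hmem using 1
    module
  · have e : (⟨m, a⟩ : DyadicInterval) = P.right :=
      DyadicInterval.ext (by simp [hP, right]) (by simp only [hP, right]; omega)
    rw [e]
    convert hmem using 1
    module

/-- Consequently two intervals of one scale with a common ancestor have indicators that agree modulo
Haar functions. -/
theorem ind_sub_ind_ancestor_mem (m a : ℤ) (n : ℕ) :
    ind ⟨m, a⟩ - ((2 : ℝ) ^ n)⁻¹ • ind ⟨m + n, a / 2 ^ n⟩ ∈ haarSpanT := by
  induction n with
  | zero => simp
  | succ n ih =>
    have h := Submodule.smul_mem _ ((2 : ℝ) ^ n)⁻¹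
      (ind_sub_half_ind_parent_mem (m + n) (a / 2 ^ n))
    convert add_mem ih h using 1
    rw [Int.ediv_ediv_of_nonneg (by positivity), ← pow_succ, Nat.cast_succ, ← add_assoc, smul_sub,
      smul_smul, ← mul_inv, ← pow_succ]
    abel

/-- The translation of indices by `N` away from the origin. -/
def awayFromZero (N a : ℤ) : ℤ := if 0 ≤ a then a + N else a - N

/-- The indicator of a small interval minus the indicator of a far away translate. -/
def indDiff (m N a : ℤ) : testFunctions := ind ⟨m, a⟩ - ind ⟨m, awayFromZero N a⟩

/-- Both intervals have the same ancestor `n + 1` levels up, of index 0 or -1. Moving away from the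
origin preserves the sign of the index; dyadic intervals never straddle 0, so a translate across it
would share no ancestor. -/
theorem indDiff_mem (m : ℤ) (n : ℕ) {a : ℤ} (ha : a ∈ Finset.Ico (-2 ^ n : ℤ) (2 ^ n)) :
    indDiff m (2 ^ n) a ∈ haarSpanT := by
  rw [Finset.mem_Ico] at ha
  have hN : (2 : ℤ) ^ (n + 1) = 2 * 2 ^ n := by ring
  have e : awayFromZero (2 ^ n) a / 2 ^ (n + 1) = a / 2 ^ (n + 1) := by
    rw [awayFromZero]
    split_ifs with h
    · rw [Int.ediv_eq_zero_of_lt (by omega) (by omega), Int.ediv_eq_zero_of_lt h (by omega)]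
    · have neg (c : ℤ) (h1 : -2 ^ (n + 1) ≤ c) (h2 : c < 0) : c / 2 ^ (n + 1) = -1 := by
        have h0 := Int.ediv_eq_zero_of_lt (a := c + 2 ^ (n + 1)) (b := 2 ^ (n + 1)) (by omega)
          (by omega)
        rw [Int.add_ediv_of_dvd_right dvd_rfl, Int.ediv_self (by positivity)] at h0
        omega
      rw [neg _ (by omega) (by omega), neg _ (by omega) (by omega)]
  have h1 := ind_sub_ind_ancestor_mem m a (n + 1)
  have h2 := ind_sub_ind_ancestor_mem m (awayFromZero (2 ^ n) a) (n + 1)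
  rw [e] at h2
  convert sub_mem h1 h2 using 1
  rw [indDiff]
  abel

theorem indDiff_apply_of_mem (m N : ℤ) {a c : ℤ} (hc : c ∈ Finset.Ico (-N) N) {x : ℝ} (hx : ⌊x / (2 : ℝ) ^ m⌋ = c) :
    (indDiff m N a).1 x = if a = c then 1 else 0 := by
  rw [Finset.mem_Ico] at hc
  rw [indDiff, testFunctions.coe_sub, ind_apply, ind_apply, hx, if_neg (c := c = awayFromZero N a),
    sub_zero]
  · simp only [eq_comm]
  · rw [awayFromZero]
    split_ifs <;> omega

theorem integral_ind (I : DyadicInterval) : ∫ x, I.ind.1 x = I.length := by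
  simp only [coe_ind]
  rw [integral_indicator_one I.measurableSet_toSet, volume_real_toSet]

theorem integrable_ind (I : DyadicInterval) : Integrable I.ind.1 :=
  (integrable_indicator_iff I.measurableSet_toSet).2
    (integrableOn_const (by rw [volume_toSet]; exact ENNReal.ofReal_ne_top))

/-- Translates leave the window `[-N, N)` and distinct indices have distinct translates, so all the
intervals involved are disjoint. The correction doubles the squared norm in each variable. -/
theorem integral_indDiff_mul_indDiff (m N : ℤ) {a c : ℤ} (ha : a ∈ Finset.Ico (-N) N)
    (hc : c ∈ Finset.Ico (-N) N) :
    ∫ x, (indDiff m N a).1 x * (indDiff m N c).1 x = if a = c then 2 * (2 : ℝ) ^ m else 0 := by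
  rw [Finset.mem_Ico] at ha hc
  split_ifs with h
  · subst h
    have hne : a ≠ awayFromZero N a := by rw [awayFromZero]; split_ifs <;> omega
    have (x : ℝ) : (indDiff m N a).1 x * (indDiff m N a).1 x
        = (ind ⟨m, a⟩).1 x + (ind ⟨m, awayFromZero N a⟩).1 x := by
      rw [indDiff, testFunctions.coe_sub, ind_apply, ind_apply]
      split_ifs with h1 h2
      · exact absurd (h1.symm.trans h2) hne
      all_goals norm_num
    simp only [this]
    rw [integral_add (integrable_ind _) (integrable_ind _), integral_ind, integral_ind, length,
      length]
    ring
  · have (x : ℝ) : (indDiff m N a).1 x * (indDiff m N c).1 x = 0 := by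
      rw [indDiff, indDiff, testFunctions.coe_sub, testFunctions.coe_sub, ind_apply, ind_apply,
        ind_apply, ind_apply, awayFromZero, awayFromZero]
      generalize ⌊x / (2 : ℝ) ^ m⌋ = k
      by_cases h1 : k = a
      · rw [if_neg (c := k = c) (by omega),
          if_neg (c := k = if 0 ≤ c then c + N else c - N) (by split_ifs <;> omega), sub_zero,
          mul_zero]
      by_cases h2 : k = if 0 ≤ a then a + N else a - N
      · rw [if_neg (c := k = c) (by split_ifs at h2 <;> omega),
          if_neg (c := k = if 0 ≤ c then c + N else c - N) (by split_ifs at h2 ⊢ <;> omega),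
          sub_zero, mul_zero]
      · rw [if_neg h1, if_neg h2, sub_zero, zero_mul]
    simp only [this, integral_zero]

end DyadicInterval

theorem tens_mem_haarSpan {φ ψ : testFunctions} (hφ : φ ∈ DyadicInterval.haarSpanT)
    (hψ : ψ ∈ DyadicInterval.haarSpanT) : tens φ ψ ∈ haarSpan := by
  have h1 : DyadicInterval.haarSpanT ≤ haarSpan.comap (tens φ) := by
    refine Submodule.span_le.2 ?_
    rintro _ ⟨L, rfl⟩
    have h2 : DyadicInterval.haarSpanT ≤ haarSpan.comap (tens.flip L.haarT) := by
      refine Submodule.span_le.2 ?_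
      rintro _ ⟨K, rfl⟩
      exact haarL2_mem_haarSpan (K, L)
    exact h2 hφ
  exact h1 hψ

theorem coeFn_sum_tens {ι : Type*} (s : Finset ι) (φ ψ : ι → testFunctions) :
    ⇑(∑ i ∈ s, tens (φ i) (ψ i)) =ᵐ[volume] fun p => ∑ i ∈ s, tensor (φ i).1 (ψ i).1 p := by
  classical
  induction s using Finset.induction_on with
  | empty =>
    filter_upwards [Lp.coeFn_zero ℝ 2 (volume : Measure (ℝ × ℝ))] with p hp
    simp
  | insert i s hi ih =>
    rw [Finset.sum_insert hi]
    filter_upwards [Lp.coeFn_add (tens (φ i) (ψ i)) (∑ i ∈ s, tens (φ i) (ψ i)), ih,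
      coeFn_tens (φ i) (ψ i)] with p h1 h2 h3
    rw [h1, Pi.add_apply, h2, h3, Finset.sum_insert hi]

theorem DyadicRectangle.volume_toSet (R : DyadicRectangle) :
    volume (DyadicRectangle.toSet R) = ENNReal.ofReal (R.1.length * R.2.length) := by
  rw [DyadicRectangle.toSet, Measure.volume_eq_prod, Measure.prod_prod,
    DyadicInterval.volume_toSet, DyadicInterval.volume_toSet,
    ENNReal.ofReal_mul R.1.length_pos.le]

/-- A dyadic open set is a union of dyadic squares of one size near the origin. -/
theorem IsDyadicOpen.exists_grid {U : Set (ℝ × ℝ)} (hU : IsDyadicOpen U) :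
    ∃ (m : ℤ) (n : ℕ), ∀ p ∈ U, ⌊p.1 / (2 : ℝ) ^ m⌋ ∈ Finset.Ico (-2 ^ n : ℤ) (2 ^ n) ∧
      ⌊p.2 / (2 : ℝ) ^ m⌋ ∈ Finset.Ico (-2 ^ n : ℤ) (2 ^ n) ∧
      DyadicRectangle.toSet (⟨m, ⌊p.1 / (2 : ℝ) ^ m⌋⟩, ⟨m, ⌊p.2 / (2 : ℝ) ^ m⌋⟩) ⊆ U := by
  obtain ⟨F, rfl⟩ := hU
  obtain ⟨m, hm⟩ : ∃ m : ℤ, ∀ R ∈ F, m ≤ R.1.scale ∧ m ≤ R.2.scale := by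
    obtain ⟨m, hm⟩ := (F.image fun R => min R.1.scale R.2.scale).bddBelow
    exact ⟨m, fun R hR => le_min_iff.1 (hm (Finset.mem_coe.2 (Finset.mem_image_of_mem _ hR)))⟩
  have hb : Bornology.IsBounded (⋃ R ∈ F, DyadicRectangle.toSet R) :=
    (Bornology.isBounded_biUnion_finset _).2 fun R _ =>
      (Metric.isBounded_Ico _ _).prod (Metric.isBounded_Ico _ _)
  obtain ⟨r, hr⟩ := hb.exists_norm_le
  -- With `2 ^ n * 2 ^ m > r`, the window of indices covers the whole set.
  obtain ⟨n, hn⟩ := pow_unbounded_of_one_lt (r / (2 : ℝ) ^ m) one_lt_two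
  have h2 : (0 : ℝ) < 2 ^ m := zpow_pos two_pos _
  rw [div_lt_iff₀ h2] at hn
  have hfloor (x : ℝ) (hx : |x| ≤ r) :
      ⌊x / (2 : ℝ) ^ m⌋ ∈ Finset.Ico (-2 ^ n : ℤ) (2 ^ n) := by
    have := abs_le.1 hx
    rw [Finset.mem_Ico, Int.le_floor, Int.floor_lt, le_div_iff₀ h2, div_lt_iff₀ h2]
    push_cast
    constructor <;> linarith
  refine ⟨m, n, fun p hp => ⟨hfloor _ ((norm_fst_le p).trans (hr p hp)),
    hfloor _ ((norm_snd_le p).trans (hr p hp)), ?_⟩⟩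
  simp only [mem_iUnion, exists_prop] at hp
  obtain ⟨R, hR, hpR⟩ := hp
  have sub (I : DyadicInterval) (hI : m ≤ I.scale) (x : ℝ) (hx : x ∈ I.toSet) :
      DyadicInterval.toSet ⟨m, ⌊x / (2 : ℝ) ^ m⌋⟩ ⊆ I.toSet := by
    rcases DyadicInterval.subset_or_disjoint (I := ⟨m, ⌊x / (2 : ℝ) ^ m⌋⟩) (K := I) hI with h | h
    · exact h
    · exact absurd hx (Set.disjoint_left.1 h ((DyadicInterval.mem_toSet_iff _ _).2 rfl))
  refine Subset.trans ?_ (subset_biUnion_of_mem (u := DyadicRectangle.toSet) hR)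
  exact prod_mono (sub _ (hm R hR).1 _ hpR.1) (sub _ (hm R hR).2 _ hpR.2)

/-- The indicator of a dyadic open set can be modified away from the set to a finite combination of
Haar functions of comparable norm. -/
theorem IsDyadicOpen.exists_haarSpan_eq_one {U : Set (ℝ × ℝ)} (hU : IsDyadicOpen U) :
    ∃ g ∈ haarSpan, (∀ᵐ p, p ∈ U → g p = 1) ∧ ‖g‖ ^ 2 = 4 * volume.real U := by
  classical
  obtain ⟨m, n, hmn⟩ := hU.exists_grid
  set N : ℤ := 2 ^ n with hN
  let square (q : ℤ × ℤ) : DyadicRectangle := (⟨m, q.1⟩, ⟨m, q.2⟩)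
  let cells : Finset (ℤ × ℤ) := {q ∈ Finset.Ico (-N) N ×ˢ Finset.Ico (-N) N |
    DyadicRectangle.toSet (square q) ⊆ U}
  have hcells {q} (hq : q ∈ cells) : q.1 ∈ Finset.Ico (-N) N ∧ q.2 ∈ Finset.Ico (-N) N :=
    Finset.mem_product.1 (Finset.mem_filter.1 hq).1
  let φ (a : ℤ) : testFunctions := DyadicInterval.indDiff m N a
  have hcell (p : ℝ × ℝ) (hp : p ∈ U) : (⌊p.1 / (2 : ℝ) ^ m⌋, ⌊p.2 / (2 : ℝ) ^ m⌋) ∈ cells :=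
    Finset.mem_filter.2 ⟨Finset.mem_product.2 ⟨(hmn p hp).1, (hmn p hp).2.1⟩, (hmn p hp).2.2⟩
  have mem_square (p : ℝ × ℝ) (q : ℤ × ℤ) : p ∈ DyadicRectangle.toSet (square q) ↔
      ⌊p.1 / (2 : ℝ) ^ m⌋ = q.1 ∧ ⌊p.2 / (2 : ℝ) ^ m⌋ = q.2 := by
    rw [DyadicRectangle.toSet, mem_prod, DyadicInterval.mem_toSet_iff,
      DyadicInterval.mem_toSet_iff]
  -- Each square of the grid becomes four signed squares, three of them outside the window and hence
  -- outside `U`. This is the source of the factor 4 in the norm.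
  refine ⟨∑ q ∈ cells, tens (φ q.1) (φ q.2), sum_mem fun q hq => tens_mem_haarSpan
    (DyadicInterval.indDiff_mem m n (hcells hq).1) (DyadicInterval.indDiff_mem m n (hcells hq).2),
    ?_, ?_⟩
  · filter_upwards [coeFn_sum_tens cells (fun q => φ q.1) fun q => φ q.2] with p hp hpU
    have h0 := hcells (hcell p hpU)
    have val (q) (_ : q ∈ cells) : tensor (φ q.1).1 (φ q.2).1 p
        = if q = (⌊p.1 / (2 : ℝ) ^ m⌋, ⌊p.2 / (2 : ℝ) ^ m⌋) then 1 else 0 := by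
      rw [tensor, DyadicInterval.indDiff_apply_of_mem m N h0.1 rfl,
        DyadicInterval.indDiff_apply_of_mem m N h0.2 rfl]
      simp only [Prod.ext_iff, ite_and]
      split_ifs <;> simp
    rw [hp, Finset.sum_congr rfl val, Finset.sum_ite_eq', if_pos (hcell p hpU)]
  · have hU' : U = ⋃ q ∈ cells, DyadicRectangle.toSet (square q) := by
      refine Subset.antisymm (fun p hp => ?_)
        (iUnion₂_subset fun q hq => (Finset.mem_filter.1 hq).2)
      exact mem_biUnion (hcell p hp) ((mem_square _ _).2 ⟨rfl, rfl⟩)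
    have hvol : volume.real U = ∑ q ∈ cells, (2 : ℝ) ^ m * (2 : ℝ) ^ m := by
      have hdisj : (cells : Set (ℤ × ℤ)).PairwiseDisjoint
          fun q => DyadicRectangle.toSet (square q) := by
        intro q _ q' _ hne
        refine Set.disjoint_left.2 fun p hp hp' => hne ?_
        rw [mem_square] at hp hp'
        exact Prod.ext (hp.1.symm.trans hp'.1) (hp.2.symm.trans hp'.2)
      rw [measureReal_def, hU', measure_biUnion_finset hdisj fun q _ =>
        (DyadicInterval.measurableSet_toSet _).prod (DyadicInterval.measurableSet_toSet _),
        ENNReal.toReal_sum fun q _ => by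
          rw [DyadicRectangle.volume_toSet]; exact ENNReal.ofReal_ne_top]
      refine Finset.sum_congr rfl fun q _ => ?_
      rw [DyadicRectangle.volume_toSet, ENNReal.toReal_ofReal]
      · rfl
      · exact (mul_pos (DyadicInterval.length_pos _) (DyadicInterval.length_pos _)).le
    rw [← real_inner_self_eq_norm_sq, sum_inner, hvol, Finset.mul_sum]
    refine Finset.sum_congr rfl fun q hq => ?_
    rw [inner_sum, Finset.sum_eq_single_of_mem q hq]
    · rw [inner_tens_tens, DyadicInterval.integral_indDiff_mul_indDiff m N (hcells hq).1
        (hcells hq).1, DyadicInterval.integral_indDiff_mul_indDiff m N (hcells hq).2 (hcells hq).2,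
        if_pos rfl, if_pos rfl]
      ring
    · intro q' hq' hne
      rw [inner_tens_tens, DyadicInterval.integral_indDiff_mul_indDiff m N (hcells hq).1
        (hcells hq').1, DyadicInterval.integral_indDiff_mul_indDiff m N (hcells hq).2
        (hcells hq').2]
      by_cases h : q.1 = q'.1
      · rw [if_neg (c := q.2 = q'.2) fun h' => hne (Prod.ext h.symm h'.symm), mul_zero]
      · rw [if_neg h, zero_mul]

/-! ### The Carleson condition. -/

theorem IsDyadicOpen.volume_ne_top {U : Set (ℝ × ℝ)} (hU : IsDyadicOpen U) : volume U ≠ ⊤ := by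
  obtain ⟨F, rfl⟩ := hU
  refine ((measure_biUnion_finset_le _ _).trans_lt (ENNReal.sum_lt_top.2 fun R _ => ?_)).ne
  rw [DyadicRectangle.volume_toSet]
  exact ENNReal.ofReal_lt_top

/-- The product Carleson condition for `b`, with the norm of the commutator alone: composing with
`(T₁ T₂)*` removes the diagonal terms that a rectangular `BMO` norm would have to absorb. -/
theorem LocallySquareIntegrable.haarEnergy_le {b : ℝ × ℝ → ℝ} (hb : LocallySquareIntegrable b)
    (hs : SkipsScales b) {U : Set (ℝ × ℝ)} (hU : IsDyadicOpen U) :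
    haarEnergy b U ≤ repeatedCommNorm b ^ 2 * volume U := by
  classical
  rw [haarEnergy, ENNReal.tsum_eq_iSup_sum]
  refine iSup_le fun F => ?_
  -- A rectangle contained in `U` gives `|U| > 0`, which the normalization requires; without one the
  -- sum is empty.
  rcases F.eq_empty_or_nonempty with rfl | ⟨R₀, -⟩
  · simp
  have hV : 0 < volume.real U := by
    refine ENNReal.toReal_pos (ne_of_gt (lt_of_lt_of_le ?_ (measure_mono R₀.2))) hU.volume_ne_top
    rw [DyadicRectangle.volume_toSet]
    exact ENNReal.ofReal_pos.2 (mul_pos R₀.1.1.length_pos R₀.1.2.length_pos)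
  obtain ⟨g, hg, hg1, hgn⟩ := hU.exists_haarSpan_eq_one
  set V := volume.real U with hVdef
  -- Since `‖g‖² = 4V`, this makes `c • g` a unit vector, and `4c² = V⁻¹` cancels the factor 4 from
  -- Bessel's inequality.
  set c : ℝ := (√(4 * V))⁻¹
  have hc2 : c ^ 2 = (4 * V)⁻¹ := by rw [inv_pow, Real.sq_sqrt (by positivity)]
  have hf : c • g ∈ haarSpan := Submodule.smul_mem _ _ hg
  have hfn : ‖c • g‖ ≤ 1 := by
    have : ‖c • g‖ ^ 2 = 1 := by
      rw [norm_smul, mul_pow, hgn, Real.norm_eq_abs, sq_abs, hc2,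
        inv_mul_cancel₀ (by positivity)]
    exact le_of_sq_le_sq (by rw [this, one_pow]) zero_le_one
  have hsum := hb.sum_haarCoeff_sq_le hs hf (c := c) (F.map (Function.Embedding.subtype _))
    fun R hR => by
      obtain ⟨R, -, rfl⟩ := Finset.mem_map.1 hR
      filter_upwards [hg1, Lp.coeFn_smul c g] with p hp hp' hpR
      rw [hp', Pi.smul_apply, hp (R.2 hpR), smul_eq_mul, mul_one]
  rw [Finset.sum_map, hc2, mul_inv, ← mul_assoc, mul_inv_cancel₀ four_ne_zero, one_mul,
    inv_mul_le_iff₀ hV] at hsum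
  have hnorm : ‖repeatedComm b (c • g)‖ₑ ≤ repeatedCommNorm b :=
    le_iSup₂_of_le (c • g) hf (le_iSup_of_le hfn le_rfl)
  calc ∑ R ∈ F, ENNReal.ofReal (haarCoeff b R ^ 2)
      = ENNReal.ofReal (∑ R ∈ F, haarCoeff b R ^ 2) :=
        (ENNReal.ofReal_sum_of_nonneg fun R _ => sq_nonneg _).symm
    _ ≤ ENNReal.ofReal (V * ‖repeatedComm b (c • g)‖ ^ 2) := ENNReal.ofReal_le_ofReal hsum
    _ = ‖repeatedComm b (c • g)‖ₑ ^ 2 * volume U := by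
        rw [ENNReal.ofReal_mul hV.le, ENNReal.ofReal_pow (norm_nonneg _), ofReal_norm, hVdef,
          measureReal_def, ENNReal.ofReal_toReal hU.volume_ne_top, mul_comm]
    _ ≤ repeatedCommNorm b ^ 2 * volume U := by gcongr

end RepeatedCommutator
end

open RepeatedCommutator in
theorem theorem9p1 :
    ∃ C₁ C₂ : ℝ≥0, ∀ b : ℝ × ℝ → ℝ, LocallySquareIntegrable b → SkipsScales b →
      ∀ U₀ : Set (ℝ × ℝ), IsDyadicOpen U₀ →
        haarEnergy b U₀ ≤ C₁ * repeatedCommNorm b ^ 2 * volume U₀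
          + C₂ * rectBMONorm b ^ 2 * volume U₀ := by
  -- The commutator term suffices. With `C₂ = 0` the second term vanishes even when the rectangular
  -- norm is infinite, as `0 * ⊤ = 0`.
  refine ⟨1, 0, fun b hb hs U₀ hU => ?_⟩
  simpa using hb.haarEnergy_le hs hU
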